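/- Let $S$ and $T$ be tangles with four ends NW, NE, SW, SE (no orientation of the ends is prescribed). Let $S+T$ be their sum, obtained by placing $T$ to the right of $S$ and joining the ends NE and SE of $S$ to the ends NW and SW of $T$, respectively. For a tangle $X$, let $N(X)$ be its numerator closure, obtained by joining NW to NE and SW to SE by simple arcs. Suppose that $N(T)$ and $N(S+T)$ are knots in $S^3$ and that $N(S)$ is a split link. Let $\Delta_K(t)\in\mathbb{Z}[t,t^{-1}]$ denote the Alexander polynomial of a knot $K$, which is defined up to multiplication by units $\pm t^k$. Then every root $t\in\mathbb{C}\setminus\{0\}$ of $\Delta_{N(T)}(t)$ is also a root of $\Delta_{N(S+T)}(t)$. -/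

import Mathlib

open scoped LaurentPolynomial

/-! ### Greatest common divisors -/

/-- Every set of Laurent polynomials has a greatest common divisor; so the one used below to define
the Alexander polynomial exists. -/
theorem LaurentPolynomial.exists_gcd (s : Set ℤ[T;T⁻¹]) :
    ∃ Δ : ℤ[T;T⁻¹], ∀ d : ℤ[T;T⁻¹], d ∣ Δ ↔ ∀ μ ∈ s, d ∣ μ := by
  have : UniqueFactorizationMonoid ℤ[T;T⁻¹] :=
    UniqueFactorizationMonoid.of_isLocalization (Submonoid.powers (Polynomial.X : Polynomial ℤ)) _
  have : IsNoetherianRing ℤ[T;T⁻¹] :=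
    IsLocalization.isNoetherianRing (Submonoid.powers (Polynomial.X : Polynomial ℤ)) _ inferInstance
  let _ : StrongNormalizationMonoid ℤ[T;T⁻¹] :=
    UniqueFactorizationMonoid.strongNormalizationMonoid
  let _ := UniqueFactorizationMonoid.toNormalizedGCDMonoid ℤ[T;T⁻¹]
  obtain ⟨F, hF⟩ := IsNoetherian.noetherian (Ideal.span s)
  refine ⟨F.gcd id, fun d => ?_⟩
  have key : ∀ u : Set ℤ[T;T⁻¹], (∀ μ ∈ u, d ∣ μ) ↔ Ideal.span u ≤ Ideal.span {d} := by
    intro u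
    rw [Ideal.span_le]
    exact forall₂_congr fun μ _ => Ideal.mem_span_singleton.symm
  have h2 := key (F : Set ℤ[T;T⁻¹])
  rw [Finset.dvd_gcd_iff, key s, ← hF]
  exact h2

/-! ### Tangle diagrams

A tangle diagram in general position with respect to a height function is cut by horizontal lines
into slices, read from bottom to top, each of which contains a single minimum, maximum or crossing;
all the other strands run vertically. -/

/-- What happens in a slice: a local minimum, a local maximum, or a crossing.  In `cross true` the
strand which runs from the bottom left to the top right is the over-strand, in `cross false` it is
the under-strand. -/
inductive SliceKind : Type
  | cup : SliceKind
  | cap : SliceKind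
  | cross : Bool → SliceKind

namespace SliceKind

/-- The number of end points at the bottom. -/
def ins : SliceKind → ℕ
  | cup => 0
  | cap => 2
  | cross _ => 2

/-- The number of end points at the top. -/
def outs : SliceKind → ℕ
  | cup => 2
  | cap => 0
  | cross _ => 2

end SliceKind

/-- A slice: its minimum, maximum or crossing has exactly `pos` vertical strands on its left. -/
structure Slice : Type where
  kind : SliceKind
  pos : ℕ

namespace Slice

/-- A minimum with `i` strands on its left. -/
def cup (i : ℕ) : Slice := ⟨.cup, i⟩

/-- A maximum with `i` strands on its left. -/
def cap (i : ℕ) : Slice := ⟨.cap, i⟩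

/-- A crossing with `i` strands on its left. -/
def cross (b : Bool) (i : ℕ) : Slice := ⟨.cross b, i⟩

/-- The number of points on the line above the slice, if there are `n` points on the line below. -/
def after (n : ℕ) (p : Slice) : ℕ := n - p.kind.ins + p.kind.outs

/-- The same slice, with `k` more strands on the left. -/
def shift (k : ℕ) (p : Slice) : Slice := ⟨p.kind, k + p.pos⟩

end Slice

/-- The slices `w`, stacked from bottom to top, fit together and lead from `m` points to `n`. -/
def Fits : ℕ → List Slice → ℕ → Prop
  | m, [], n => m = n
  | m, p :: w, n => p.pos + p.kind.ins ≤ m ∧ Fits (p.after m) w n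

theorem Fits.append {m n k : ℕ} {v w : List Slice} (hv : Fits m v n) (hw : Fits n w k) :
    Fits m (v ++ w) k := by
  induction v generalizing m with
  | nil => cases hv; exact hw
  | cons p v ih => exact ⟨hv.1, ih hv.2⟩

theorem Fits.right {m n : ℕ} {v : List Slice} (hv : Fits m v n) (k : ℕ) :
    Fits (m + k) v (n + k) := by
  induction v generalizing m with
  | nil => cases hv; rfl
  | cons p v ih =>
    have h := ih hv.2
    have h1 := hv.1
    refine ⟨by omega, ?_⟩
    have e : p.after (m + k) = p.after m + k := by simp only [Slice.after]; omega
    rw [e]; exact h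

theorem Fits.left {m n : ℕ} {v : List Slice} (hv : Fits m v n) (k : ℕ) :
    Fits (k + m) (v.map (Slice.shift k)) (k + n) := by
  induction v generalizing m with
  | nil => cases hv; rfl
  | cons p v ih =>
    have h := ih hv.2
    have h1 := hv.1
    refine ⟨by simp only [Slice.shift]; omega, ?_⟩
    have e : (p.shift k).after (k + m) = k + p.after m := by
      simp only [Slice.after, Slice.shift]; omega
    rw [e]; exact h

/-- An unoriented tangle diagram with `m` end points at the bottom and `n` at the top. -/
structure Tangle (m n : ℕ) : Type where
  word : List Slice
  fits : Fits m word n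

/-- A link diagram. -/
abbrev LinkDiagram : Type := Tangle 0 0

namespace Tangle

/-- `E` stacked on top of `D`. -/
def stack {m n k : ℕ} (D : Tangle m n) (E : Tangle n k) : Tangle m k :=
  ⟨D.word ++ E.word, D.fits.append E.fits⟩

/-! A tangle with four ends is a diagram in `Tangle 2 2`: its ends NW, NE are at the top and its
ends SW, SE are at the bottom. -/

/-- The sum `S + T`: `T` is placed to the right of `S`, the end NE of `S` is joined to the end NW of
`T`, and the end SE of `S` to the end SW of `T`. -/
def sum (S T : Tangle 2 2) : Tangle 2 2 where
  word := [Slice.cup 1] ++ (S.word ++ T.word.map (Slice.shift 2)) ++ [Slice.cap 1]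
  fits := by
    have h1 : Fits 2 [Slice.cup 1] 4 := by
      simp [Fits, Slice.cup, Slice.after, SliceKind.ins, SliceKind.outs]
    have h2 : Fits 4 [Slice.cap 1] 2 := by
      simp [Fits, Slice.cap, Slice.after, SliceKind.ins, SliceKind.outs]
    exact (h1.append ((S.fits.right 2).append (T.fits.left 2))).append h2

/-- The numerator closure `N(T)`: the ends NW and NE are joined by an arc, and so are the ends SW
and SE. -/
def numerator (T : Tangle 2 2) : LinkDiagram where
  word := [Slice.cup 0] ++ T.word ++ [Slice.cap 0]
  fits := by
    have h1 : Fits 0 [Slice.cup 0] 2 := by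
      simp [Fits, Slice.cup, Slice.after, SliceKind.ins, SliceKind.outs]
    have h2 : Fits 2 [Slice.cap 0] 0 := by
      simp [Fits, Slice.cap, Slice.after, SliceKind.ins, SliceKind.outs]
    exact (h1.append T.fits).append h2

end Tangle

/-! ### Isotopy -/

/-- The moves which generate isotopy of tangles: planar isotopies (distant slices are exchanged, a
minimum cancels against an adjacent maximum, a strand slides across a minimum or a maximum) and the
three Reidemeister moves. -/
inductive Move : List Slice → List Slice → Prop
  | exchange (A B : SliceKind) (i d : ℕ) :
      Move [⟨A, i⟩, ⟨B, i + A.outs + d⟩] [⟨B, i + A.ins + d⟩, ⟨A, i⟩]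
  | zigzag_left (i : ℕ) : Move [Slice.cup i, Slice.cap (i + 1)] []
  | zigzag_right (i : ℕ) : Move [Slice.cup (i + 1), Slice.cap i] []
  | slide_cup (b : Bool) (i : ℕ) :
      Move [Slice.cup i, Slice.cross b (i + 1)] [Slice.cup (i + 1), Slice.cross (!b) i]
  | slide_cap (b : Bool) (i : ℕ) :
      Move [Slice.cross b (i + 1), Slice.cap i] [Slice.cross (!b) i, Slice.cap (i + 1)]
  | reidemeister_one_cup (b : Bool) (i : ℕ) : Move [Slice.cup i, Slice.cross b i] [Slice.cup i]
  | reidemeister_one_cap (b : Bool) (i : ℕ) : Move [Slice.cross b i, Slice.cap i] [Slice.cap i]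
  | reidemeister_two (b : Bool) (i : ℕ) : Move [Slice.cross b i, Slice.cross (!b) i] []
  | reidemeister_three (b : Bool) (i : ℕ) :
      Move [Slice.cross b i, Slice.cross b (i + 1), Slice.cross b i]
        [Slice.cross b (i + 1), Slice.cross b i, Slice.cross b (i + 1)]

namespace Tangle

/-- `E` arises from `D` by a move performed on some consecutive slices. -/
def Step {m n : ℕ} (D E : Tangle m n) : Prop :=
  ∃ v v' a b : List Slice, Move a b ∧ D.word = v ++ a ++ v' ∧ E.word = v ++ b ++ v'

/-- The two diagrams represent isotopic tangles. -/
def Isotopic {m n : ℕ} : Tangle m n → Tangle m n → Prop := Relation.EqvGen Step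

end Tangle

/-- The link is split: it is isotopic to a union of two nonempty links, the diagrams of which are
separated by a line. -/
def Tangle.IsSplit (L : LinkDiagram) : Prop :=
  ∃ L₁ L₂ : LinkDiagram, L₁.word ≠ [] ∧ L₂.word ≠ [] ∧ L.Isotopic (L₁.stack L₂)

/-! ### Strands

The horizontal lines which separate the slices cut the strands at finitely many points.  The pair
`(k, j)` stands for the point number `j` (counted from the left, starting with 0) on line number `k`
(counted from the bottom, starting with 0); the slice number `k` lies between the lines `k` and
`k + 1`.  -/

namespace Tangle

variable {m n : ℕ}

/-- The number of points on line `k`. -/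
def width (D : Tangle m n) (k : ℕ) : ℕ := (D.word.take k).foldl Slice.after m

/-- The set of all points where the diagram meets the separating lines. -/
def points (D : Tangle m n) : Finset (ℕ × ℕ) :=
  (Finset.range (D.word.length + 1)).biUnion
    fun k => (Finset.range (D.width k)).map ⟨fun j => (k, j), fun _ _ h => (Prod.mk.inj h).2⟩

/-- A strand runs vertically through a slice, from the first point to the second. -/
inductive Straight (D : Tangle m n) : ℕ × ℕ → ℕ × ℕ → Prop
  | left (k j : ℕ) (p : Slice) : D.word[k]? = some p → j < p.pos → Straight D (k, j) (k + 1, j)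
  | right (k d : ℕ) (p : Slice) : D.word[k]? = some p →
      Straight D (k, p.pos + p.kind.ins + d) (k + 1, p.pos + p.kind.outs + d)

/-- The over-strand of a crossing runs from the first point up to the second. -/
inductive OverStrand (D : Tangle m n) : ℕ × ℕ → ℕ × ℕ → Prop
  | rising (k i : ℕ) : D.word[k]? = some (Slice.cross true i) → OverStrand D (k, i) (k + 1, i + 1)
  | falling (k i : ℕ) : D.word[k]? = some (Slice.cross false i) →
      OverStrand D (k, i + 1) (k + 1, i)

/-- The under-strand of a crossing runs from the first point up to the second. -/
inductive UnderStrand (D : Tangle m n) : ℕ × ℕ → ℕ × ℕ → Prop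
  | falling (k i : ℕ) : D.word[k]? = some (Slice.cross true i) →
      UnderStrand D (k, i + 1) (k + 1, i)
  | rising (k i : ℕ) : D.word[k]? = some (Slice.cross false i) →
      UnderStrand D (k, i) (k + 1, i + 1)

/-- The two points are joined by a minimum or a maximum. -/
inductive Turn (D : Tangle m n) : ℕ × ℕ → ℕ × ℕ → Prop
  | cup (k i : ℕ) : D.word[k]? = some (Slice.cup i) → Turn D (k + 1, i) (k + 1, i + 1)
  | cap (k i : ℕ) : D.word[k]? = some (Slice.cap i) → Turn D (k, i) (k, i + 1)

/-- The two points follow each other on a strand. -/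
def Adjacent (D : Tangle m n) (a b : ℕ × ℕ) : Prop :=
  D.Straight a b ∨ D.OverStrand a b ∨ D.UnderStrand a b ∨ D.Turn a b

/-- The link has exactly one component. -/
def IsKnot (L : LinkDiagram) : Prop :=
  L.points.Nonempty ∧ ∀ a ∈ L.points, ∀ b ∈ L.points, Relation.EqvGen L.Adjacent a b

/-- An orientation, given by the points at which it is directed upwards. -/
def IsOrientation (D : Tangle m n) (up : ℕ × ℕ → Bool) : Prop :=
  (∀ a b, D.Straight a b ∨ D.OverStrand a b ∨ D.UnderStrand a b → up a = up b) ∧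
    ∀ a b, D.Turn a b → up a ≠ up b

/-! ### The Alexander polynomial -/

/-- The Fox derivatives, abelianized, of the relation `z = y x y⁻¹` between three meridians. -/
noncomputable def foxRow (z x y : ℕ × ℕ) : ℕ × ℕ → ℤ[T;T⁻¹] :=
  Pi.single z 1 - LaurentPolynomial.T 1 • Pi.single x 1
    - (1 - LaurentPolynomial.T 1 : ℤ[T;T⁻¹]) • Pi.single y 1

/-- The rows of the Alexander matrix of the Wirtinger presentation, in which every point gives a
generator.  The meridians at two points are equal if no undercrossing lies between them; at a
crossing, if `y` is the meridian of the over-strand, and `z` and `x` are the meridians of the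
under-strand to the left and to the right of the over-strand, then `z = y x y⁻¹`. -/
inductive AlexanderRow (D : Tangle m n) (up : ℕ × ℕ → Bool) : (ℕ × ℕ → ℤ[T;T⁻¹]) → Prop
  | same (a b : ℕ × ℕ) : D.Straight a b ∨ D.OverStrand a b ∨ D.Turn a b →
      AlexanderRow D up (Pi.single a 1 - Pi.single b 1)
  | rising_up (k i : ℕ) : D.word[k]? = some (Slice.cross true i) → up (k, i) = true →
      AlexanderRow D up (foxRow (k + 1, i) (k, i + 1) (k, i))
  | rising_down (k i : ℕ) : D.word[k]? = some (Slice.cross true i) → up (k, i) = false →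
      AlexanderRow D up (foxRow (k, i + 1) (k + 1, i) (k, i))
  | falling_up (k i : ℕ) : D.word[k]? = some (Slice.cross false i) → up (k, i + 1) = true →
      AlexanderRow D up (foxRow (k, i) (k + 1, i + 1) (k, i + 1))
  | falling_down (k i : ℕ) : D.word[k]? = some (Slice.cross false i) → up (k, i + 1) = false →
      AlexanderRow D up (foxRow (k + 1, i + 1) (k, i) (k, i + 1))

/-- The minors of the Alexander matrix whose size is the number of generators minus one; they
generate the first elementary ideal. -/
def AlexanderMinor (D : Tangle m n) (up : ℕ × ℕ → Bool) (d : ℤ[T;T⁻¹]) : Prop :=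
  ∃ (r : Fin (D.points.card - 1) → ℕ × ℕ → ℤ[T;T⁻¹]) (c : Fin (D.points.card - 1) → ℕ × ℕ),
    (∀ a, D.AlexanderRow up (r a)) ∧ (∀ b, c b ∈ D.points) ∧
      d = (Matrix.of fun a b => r a (c b)).det

/-- `Δ` is the Alexander polynomial of the knot `K`: a greatest common divisor of the minors of the
Alexander matrix (that is, a generator of the smallest principal ideal which contains the first
elementary ideal), well defined up to units of `ℤ[t, t⁻¹]`.  A knot has two orientations; we use the
one for which the first minimum of the diagram is run through from left to right. -/
def IsAlexanderPolynomial (K : LinkDiagram) (Δ : ℤ[T;T⁻¹]) : Prop :=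
  ∃ up : ℕ × ℕ → Bool, K.IsOrientation up ∧ up (1, 0) = false ∧
    ∀ d : ℤ[T;T⁻¹], d ∣ Δ ↔ ∀ μ, K.AlexanderMinor up μ → d ∣ μ

end Tangle

/-! Fix `z ≠ 0`. Evaluated at `z`, the Alexander matrix is a linear system whose solutions are the
Alexander colorings: complex labels that are unchanged along a strand and at overcrossings, and obey
`x ↦ z^{±1} x + (1 - z^{±1}) y` when passing under a strand labelled `y`. Constants always solve it,
and the minors all vanish exactly when some solution is not constant
(`Finset.exists_relation_of_minors_eq_zero`, `Finset.minor_eq_zero`). The integral polynomials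
vanishing at `z` are the multiples of a single one, so the minors vanish at `z` if and only if their
gcd does. Thus a nonconstant coloring of `N(T)` has to be turned into one of `N(S + T)`.

The split link `N(S)` always has a nonconstant coloring `s` (`exists_isColoring_of_isSplit`): label
one part by `1`, the other by `0`, and carry this through the moves. In `N(S)` the closing arcs
force one label `a` at both bottom ends of `S` and one label `b` at both top ends; the same holds
for the given coloring `c` of `N(T)`. If `a = b`, extend `s` over `T` by the constant `a`. If `a ≠
b`, some affine map, under which colorings are stable, sends `a` and `b` to the end labels of `c`,
and the result glues to `c`. Either way the glued coloring is nonconstant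
(`exists_isColoring_sum_of_numerator`).

The orientations must match too: that of `N(S + T)` has to restrict to orientations of `N(S)` and
`N(T)`, so the bottom ends of `S` must be oppositely directed, and likewise the top ends
(`ends_ne`). Otherwise flow conservation would give every coloring of `N(S)` that is constant on
components the same label at all four ends of `S`. Such a coloring extends over `T`, hence is
constant because `N(S + T)` is a knot; but a split link has a nonconstant one. This is the case of
weight `1`, which is why directions and weights are kept abstract in `Directing`. -/

/-! ### Colorings by symmetric quandles -/

/-- A quandle with a good involution.  The label `star x` is the label `x` with the direction of
the strand reversed. -/
structure SymmetricQuandle (X : Type*) where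
  star : X → X
  act : X → X → X
  star_star : ∀ x, star (star x) = x
  act_star : ∀ y x, act y (star x) = star (act y x)
  star_act_act : ∀ y x, act (star y) (act y x) = x
  act_self : ∀ x, act x x = x
  act_act : ∀ x y z, act x (act y z) = act (act x y) (act x z)

namespace SymmetricQuandle

variable {X : Type*} (Q : SymmetricQuandle X)

theorem act_star_act (y x : X) : Q.act y (Q.act (Q.star y) x) = x := by
  simpa only [Q.star_star] using Q.star_act_act (Q.star y) x

/-- The condition on the labels at a minimum, a maximum or a crossing. -/
def Vertex : SliceKind → (ℕ → X) → (ℕ → X) → Prop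
  | .cup, _, g => g 1 = Q.star (g 0)
  | .cap, f, _ => f 1 = Q.star (f 0)
  | .cross true, f, g => g 0 = Q.act (f 0) (f 1) ∧ g 1 = f 0
  | .cross false, f, g => g 0 = f 1 ∧ g 1 = Q.act (Q.star (f 1)) (f 0)

variable {Q} in
theorem Vertex.congr {A : SliceKind} {f g f' g' : ℕ → X} (h : Q.Vertex A f g)
    (hf : ∀ e < A.ins, f' e = f e) (hg : ∀ e < A.outs, g' e = g e) : Q.Vertex A f' g' := by
  rcases A with _ | _ | (_ | _) <;>
    simp_all [Vertex, SliceKind.ins, SliceKind.outs]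

/-- The labels below and above a slice are compatible. -/
def Across (p : Slice) (s s' : ℕ → X) : Prop :=
  (∀ j < p.pos, s' j = s j) ∧
    (∀ d, s' (p.pos + p.kind.outs + d) = s (p.pos + p.kind.ins + d)) ∧
      Q.Vertex p.kind (fun e => s (p.pos + e)) (fun e => s' (p.pos + e))

/-- `c k j` is the label of the point number `j` on the line number `k`. -/
def IsColoring (w : List Slice) (c : ℕ → ℕ → X) : Prop :=
  ∀ k p, w[k]? = some p → Q.Across p (c k) (c (k + 1))

theorem isColoring_nil (c : ℕ → ℕ → X) : Q.IsColoring [] c := by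
  intro k p h; simp at h

theorem isColoring_cons {p : Slice} {w : List Slice} {c : ℕ → ℕ → X} :
    Q.IsColoring (p :: w) c ↔ Q.Across p (c 0) (c 1) ∧ Q.IsColoring w (fun k => c (k + 1)) := by
  constructor
  · intro h
    exact ⟨h 0 p (by simp), fun k q hq => h (k + 1) q (by simpa using hq)⟩
  · rintro ⟨h, h'⟩ (_ | k) q hq
    · simp at hq; subst hq; exact h
    · exact h' k q (by simpa using hq)

theorem isColoring_append {v w : List Slice} {c : ℕ → ℕ → X} :
    Q.IsColoring (v ++ w) c ↔
      Q.IsColoring v c ∧ Q.IsColoring w (fun k => c (v.length + k)) := by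
  induction v generalizing c with
  | nil => simp [isColoring_nil]
  | cons p v ih =>
    simp only [List.cons_append, isColoring_cons, ih, and_assoc, List.length_cons]
    have : (fun k => c (v.length + k + 1)) = fun k => c (v.length + 1 + k) := by
      funext k; congr 1; omega
    rw [this]

variable {Q}

theorem IsColoring.congr {w : List Slice} {c c' : ℕ → ℕ → X} (h : Q.IsColoring w c)
    (hc : ∀ k ≤ w.length, c' k = c k) : Q.IsColoring w c' := by
  intro k p hp
  have hk : k < w.length := (List.getElem?_eq_some_iff.1 hp).1
  rw [hc k hk.le, hc (k + 1) hk]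
  exact h k p hp

theorem IsColoring.glue {v w : List Slice} {c c' : ℕ → ℕ → X} (h : Q.IsColoring v c)
    (h' : Q.IsColoring w c') (hc : c v.length = c' 0) :
    ∃ d, Q.IsColoring (v ++ w) d ∧ (∀ k ≤ v.length, d k = c k) ∧ ∀ k, d (v.length + k) = c' k := by
  have h2 : ∀ k, (fun k => if k ≤ v.length then c k else c' (k - v.length)) (v.length + k)
      = c' k := by
    rintro (_ | k)
    · simp [hc]
    · simp
  have h1 : ∀ k ≤ v.length, (fun k => if k ≤ v.length then c k else c' (k - v.length)) k = c k := by
    intro k hk; simp [hk]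
  exact ⟨_, Q.isColoring_append.2 ⟨h.congr h1, h'.congr fun k _ => h2 k⟩, h1, h2⟩

/-! The labels above a slice in terms of the labels below. -/

theorem across_cup {i : ℕ} {s s' : ℕ → X} : Q.Across (Slice.cup i) s s' ↔
    ∃ x, s' = fun j => if j < i then s j else if j = i then x else
      if j = i + 1 then Q.star x else s (j - 2) := by
  constructor
  · rintro ⟨h1, h2, h3⟩
    refine ⟨s' i, funext fun j => ?_⟩
    simp only [Slice.cup, SliceKind.ins, SliceKind.outs, Vertex, add_zero] at h1 h2 h3
    have h4 := h2 (j - 2 - i)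
    split_ifs with a b c
    · exact h1 j a
    · rw [b]
    · rw [c, h3]
    · rw [← show i + (j - 2 - i) = j - 2 by omega, ← h4]; congr 1; omega
  · rintro ⟨x, h⟩
    have e := congrFun h
    refine ⟨fun j hj => (e j).trans (if_pos hj), fun d => ?_, ?_⟩
    · change s' (i + 2 + d) = s (i + 0 + d)
      rw [e, if_neg (by omega), if_neg (by omega), if_neg (by omega)]; congr 1; omega
    · simp [Slice.cup, Vertex, e]

theorem across_cap {i : ℕ} {s s' : ℕ → X} : Q.Across (Slice.cap i) s s' ↔
    s (i + 1) = Q.star (s i) ∧ s' = fun j => if j < i then s j else s (j + 2) := by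
  constructor
  · rintro ⟨h1, h2, h3⟩
    simp only [Slice.cap, SliceKind.ins, SliceKind.outs, Vertex, add_zero] at h1 h2 h3
    refine ⟨h3, funext fun j => ?_⟩
    have h4 := h2 (j - i)
    split_ifs with a
    · exact h1 j a
    · rw [← show i + (j - i) = j by omega, h4]; congr 1; omega
  · rintro ⟨h, h'⟩
    have e := congrFun h'
    refine ⟨fun j hj => (e j).trans (if_pos hj), fun d => ?_, h⟩
    change s' (i + 0 + d) = s (i + 2 + d)
    rw [e, if_neg (by omega)]; congr 1; omega

theorem across_cross {b : Bool} {i : ℕ} {s s' : ℕ → X} : Q.Across (Slice.cross b i) s s' ↔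
    s' = fun j => if j = i then (if b then Q.act (s i) (s (i + 1)) else s (i + 1)) else
      if j = i + 1 then (if b then s i else Q.act (Q.star (s (i + 1))) (s i)) else s j := by
  constructor
  · rintro ⟨h1, h2, h3⟩
    refine funext fun j => ?_
    simp only [Slice.cross, SliceKind.ins, SliceKind.outs] at h1 h2 h3
    have h4 := h2 (j - 2 - i)
    by_cases a : j = i
    · subst a; cases b <;> simp_all [Vertex]
    by_cases a : j = i + 1
    · subst a; cases b <;> simp_all [Vertex]
    rw [if_neg (by assumption), if_neg (by assumption)]
    by_cases c : j < i
    · exact h1 j c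
    · rwa [show i + 2 + (j - 2 - i) = j by omega] at h4
  · intro h
    have e := congrFun h
    refine ⟨fun j hj => ?_, fun d => ?_, ?_⟩
    · change j < i at hj
      rw [e, if_neg (by omega), if_neg (by omega)]
    · change s' (i + 2 + d) = s (i + 2 + d)
      rw [e, if_neg (by omega), if_neg (by omega)]
    · cases b <;> simp [Slice.cross, Vertex, e]

/-! ### Moves -/

variable (Q)

/-- Every coloring of `a` can be replaced by a coloring of `b` with the same labels at the bottom
and at the top. -/
def Transfers (a b : List Slice) : Prop :=
  ∀ c, Q.IsColoring a c →
    ∃ c', Q.IsColoring b c' ∧ c' 0 = c 0 ∧ c' b.length = c a.length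

/-- A coloring is determined by the labels at the bottom and at the top. -/
def Rigid (a : List Slice) : Prop :=
  ∀ c c', Q.IsColoring a c → Q.IsColoring a c' → c 0 = c' 0 → c a.length = c' a.length →
    ∀ k ≤ a.length, c k = c' k

variable {Q}

/-- The two slices act on disjoint ranges of points, so the new middle line takes its labels from
below to the left of `B` and from above from `B` on. -/
theorem Across.exchange {A B : SliceKind} {i d : ℕ} {s₀ s₁ s₂ : ℕ → X}
    (hA : Q.Across ⟨A, i⟩ s₀ s₁) (hB : Q.Across ⟨B, i + A.outs + d⟩ s₁ s₂) :
    ∃ s, Q.Across ⟨B, i + A.ins + d⟩ s₀ s ∧ Q.Across ⟨A, i⟩ s s₂ := by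
  obtain ⟨a1, a2, a3⟩ := hA
  obtain ⟨b1, b2, b3⟩ := hB
  dsimp only at a1 a2 a3 b1 b2 b3
  have a4 : ∀ j, s₁ (i + A.outs + d + j) = s₀ (i + A.ins + d + j) := fun j => by
    simpa only [add_assoc] using a2 (d + j)
  have e : ∀ j, j < i + A.ins + d → (fun j => if j < i + A.ins + d then s₀ j
      else s₂ (j - A.ins + A.outs)) j = s₀ j := fun j hj => if_pos hj
  have e' : ∀ j, (fun j => if j < i + A.ins + d then s₀ j
      else s₂ (j - A.ins + A.outs)) (i + A.ins + d + j) = s₂ (i + A.outs + d + j) := by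
    intro j
    simp only
    rw [if_neg (by omega)]; congr 1; omega
  generalize (fun j => if j < i + A.ins + d then s₀ j else s₂ (j - A.ins + A.outs)) = s at e e'
  refine ⟨s, ⟨e, fun j => ?_, b3.congr (fun j _ => ?_) (fun j _ => e' j)⟩,
    fun j hj => ?_, fun j => ?_, a3.congr (fun j hj => e _ (by dsimp only at hj ⊢; omega))
      (fun j hj => b1 _ (by dsimp only at hj ⊢; omega))⟩
  · dsimp only
    rw [add_assoc, e', ← add_assoc, b2, add_assoc _ B.ins, a4, ← add_assoc]
  · exact (a4 _).symm
  · dsimp only at hj ⊢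
    rw [e _ (by omega), b1 _ (by omega), a1 _ hj]
  · dsimp only
    by_cases h : j < d
    · rw [e _ (by omega), b1 _ (by omega), a2]
    · rw [show i + A.ins + j = i + A.ins + d + (j - d) by omega, e']
      congr 1; omega

theorem Across.exchange_symm {A B : SliceKind} {i d : ℕ} {s₀ s₁ s₂ : ℕ → X}
    (hB : Q.Across ⟨B, i + A.ins + d⟩ s₀ s₁) (hA : Q.Across ⟨A, i⟩ s₁ s₂) :
    ∃ s, Q.Across ⟨A, i⟩ s₀ s ∧ Q.Across ⟨B, i + A.outs + d⟩ s s₂ := by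
  obtain ⟨a1, a2, a3⟩ := hA
  obtain ⟨b1, b2, b3⟩ := hB
  dsimp only at a1 a2 a3 b1 b2 b3
  have a4 : ∀ j, s₂ (i + A.outs + d + j) = s₁ (i + A.ins + d + j) := fun j => by
    simpa only [add_assoc] using a2 (d + j)
  have e : ∀ j, j < i + A.outs + d → (fun j => if j < i + A.outs + d then s₂ j
      else s₀ (j - A.outs + A.ins)) j = s₂ j := fun j hj => if_pos hj
  have e' : ∀ j, (fun j => if j < i + A.outs + d then s₂ j
      else s₀ (j - A.outs + A.ins)) (i + A.outs + d + j) = s₀ (i + A.ins + d + j) := by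
    intro j
    simp only
    rw [if_neg (by omega)]; congr 1; omega
  generalize (fun j => if j < i + A.outs + d then s₂ j else s₀ (j - A.outs + A.ins)) = s at e e'
  refine ⟨s, ⟨fun j hj => ?_, fun j => ?_, a3.congr (fun j hj => ?_)
      (fun j hj => e _ (by dsimp only at hj ⊢; omega))⟩,
    fun j hj => (e j hj).symm, fun j => ?_, b3.congr (fun j _ => e' j) (fun j hj => ?_)⟩
  · dsimp only at hj ⊢
    rw [e _ (by omega), a1 _ hj, b1 _ (by omega)]
  · dsimp only
    by_cases h : j < d
    · rw [e _ (by omega), a2, b1 _ (by omega)]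
    · rw [show i + A.outs + j = i + A.outs + d + (j - d) by omega, e']
      congr 1; omega
  · dsimp only at hj ⊢
    rw [b1 _ (by omega)]
  · dsimp only
    rw [add_assoc, a4, add_assoc (i + A.outs + d) B.ins, e', ← add_assoc, b2, ← add_assoc]
  · exact a4 _

/-- A label on the middle line is seen unchanged on the top line to the left of `B`, and on the
bottom line to the right of `A`; these two regions cover everything. -/
theorem Across.exchange_unique {A B : SliceKind} {i d : ℕ} {s₀ s₁ s₁' s₂ : ℕ → X}
    (hA : Q.Across ⟨A, i⟩ s₀ s₁) (hB : Q.Across ⟨B, i + A.outs + d⟩ s₁ s₂)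
    (hA' : Q.Across ⟨A, i⟩ s₀ s₁') (hB' : Q.Across ⟨B, i + A.outs + d⟩ s₁' s₂) : s₁ = s₁' := by
  funext j
  by_cases h : j < i + A.outs + d
  · rw [← hB.1 j h, ← hB'.1 j h]
  · have h1 := hA.2.1 (j - (i + A.outs))
    have h2 := hA'.2.1 (j - (i + A.outs))
    dsimp only at h1 h2
    rw [show i + A.outs + (j - (i + A.outs)) = j by omega] at h1 h2
    rw [h1, h2]

theorem Across.exchange_symm_unique {A B : SliceKind} {i d : ℕ} {s₀ s₁ s₁' s₂ : ℕ → X}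
    (hB : Q.Across ⟨B, i + A.ins + d⟩ s₀ s₁) (hA : Q.Across ⟨A, i⟩ s₁ s₂)
    (hB' : Q.Across ⟨B, i + A.ins + d⟩ s₀ s₁') (hA' : Q.Across ⟨A, i⟩ s₁' s₂) : s₁ = s₁' := by
  funext j
  by_cases h : j < i + A.ins + d
  · rw [hB.1 j h, hB'.1 j h]
  · have h1 := hA.2.1 (j - (i + A.ins))
    have h2 := hA'.2.1 (j - (i + A.ins))
    dsimp only at h1 h2
    rw [show i + A.ins + (j - (i + A.ins)) = j by omega] at h1 h2
    rw [← h1, ← h2]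

variable (Q)

theorem transfers_of_exists {p q p' q' : Slice}
    (h : ∀ s₀ s₁ s₂, Q.Across p s₀ s₁ → Q.Across q s₁ s₂ →
      ∃ s, Q.Across p' s₀ s ∧ Q.Across q' s s₂) : Q.Transfers [p, q] [p', q'] := by
  intro c hc
  simp only [isColoring_cons, isColoring_nil, and_true] at hc
  obtain ⟨s, h1, h2⟩ := h _ _ _ hc.1 hc.2
  refine ⟨fun k => if k = 0 then c 0 else if k = 1 then s else c 2, ?_, by simp, by simp⟩
  simp [isColoring_cons, isColoring_nil, h1, h2]

theorem rigid_pair {p q : Slice}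
    (h : ∀ s₀ s₁ s₁' s₂, Q.Across p s₀ s₁ → Q.Across q s₁ s₂ → Q.Across p s₀ s₁' →
      Q.Across q s₁' s₂ → s₁ = s₁') : Q.Rigid [p, q] := by
  intro c c' hc hc' h0 h2 k hk
  simp only [isColoring_cons, isColoring_nil, and_true, zero_add, Nat.reduceAdd] at hc hc'
  simp only [List.length_cons, List.length_nil, zero_add, Nat.reduceAdd] at h2 hk
  have h1 := h _ _ _ _ hc.1 hc.2 (h0 ▸ hc'.1) (h2 ▸ hc'.2)
  interval_cases k <;> assumption

theorem rigid_nil : Q.Rigid [] := by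
  intro c c' _ _ h _ k hk
  simp at hk
  rw [hk, h]

theorem rigid_singleton (p : Slice) : Q.Rigid [p] := by
  intro c c' _ _ h h' k hk
  simp at h' hk
  interval_cases k <;> assumption

variable {Q}

theorem Across.eq_of_cross {b : Bool} {i : ℕ} {s t t' : ℕ → X}
    (h : Q.Across (Slice.cross b i) s t) (h' : Q.Across (Slice.cross b i) s t') : t = t' := by
  rw [across_cross] at h h'
  rw [h, h']

theorem Across.eq_of_cup {i : ℕ} {s s' t : ℕ → X}
    (h : Q.Across (Slice.cup i) s t) (h' : Q.Across (Slice.cup i) s' t) : s = s' := by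
  funext j
  by_cases a : j < i
  · rw [← h.1 j a, ← h'.1 j a]
  · have h1 := h.2.1 (j - i)
    have h2 := h'.2.1 (j - i)
    simp only [Slice.cup, SliceKind.ins, add_zero] at h1 h2
    rw [show i + (j - i) = j by omega] at h1 h2
    rw [← h1, ← h2]

variable (Q)

theorem transfers_zigzag_left (i : ℕ) : Q.Transfers [Slice.cup i, Slice.cap (i + 1)] [] := by
  intro c hc
  simp only [isColoring_cons, isColoring_nil, and_true, across_cup, across_cap, zero_add,
    Nat.reduceAdd] at hc
  obtain ⟨⟨x, h1⟩, h2, h3⟩ := hc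
  refine ⟨fun _ => c 0, Q.isColoring_nil _, rfl, ?_⟩
  change c 0 = c 2
  have := Q.star_star x
  rw [h3]
  rw [h1] at h2 ⊢
  funext j
  grind

theorem transfers_zigzag_left_symm (i : ℕ) : Q.Transfers [] [Slice.cup i, Slice.cap (i + 1)] := by
  intro c _
  refine ⟨fun k => if k = 1 then (fun j => if j < i then c 0 j else if j = i then c 0 i else
      if j = i + 1 then Q.star (c 0 i) else c 0 (j - 2)) else c 0, ?_, rfl, rfl⟩
  simp only [isColoring_cons, isColoring_nil, and_true, across_cup, across_cap, zero_add,
    Nat.reduceAdd]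
  refine ⟨⟨c 0 i, rfl⟩, ?_, funext fun j => ?_⟩
  · have := Q.star_star (c 0 i)
    simp only [reduceIte]
    grind
  · grind

/-- The free label of the minimum survives at position `i` of the top line. -/
theorem rigid_zigzag_left (i : ℕ) : Q.Rigid [Slice.cup i, Slice.cap (i + 1)] := by
  refine Q.rigid_pair fun s₀ s₁ s₁' s₂ h1 h2 h1' h2' => ?_
  rw [across_cup] at h1 h1'
  rw [across_cap] at h2 h2'
  obtain ⟨x, h1⟩ := h1
  obtain ⟨y, h1'⟩ := h1'
  have : x = y := by
    have e := congrFun (h2.2.symm.trans h2'.2) i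
    grind
  rw [h1, h1', this]

theorem transfers_zigzag_right (i : ℕ) : Q.Transfers [Slice.cup (i + 1), Slice.cap i] [] := by
  intro c hc
  simp only [isColoring_cons, isColoring_nil, and_true, across_cup, across_cap, zero_add,
    Nat.reduceAdd] at hc
  obtain ⟨⟨x, h1⟩, h2, h3⟩ := hc
  refine ⟨fun _ => c 0, Q.isColoring_nil _, rfl, ?_⟩
  change c 0 = c 2
  have := Q.star_star (c 0 i)
  rw [h3]
  rw [h1] at h2 ⊢
  funext j
  grind

theorem transfers_zigzag_right_symm (i : ℕ) : Q.Transfers [] [Slice.cup (i + 1), Slice.cap i] := by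
  intro c _
  refine ⟨fun k => if k = 1 then (fun j => if j < i + 1 then c 0 j else
      if j = i + 1 then Q.star (c 0 i) else
      if j = i + 1 + 1 then Q.star (Q.star (c 0 i)) else c 0 (j - 2)) else c 0, ?_, rfl, rfl⟩
  simp only [isColoring_cons, isColoring_nil, and_true, across_cup, across_cap, zero_add,
    Nat.reduceAdd]
  refine ⟨⟨Q.star (c 0 i), rfl⟩, ?_, funext fun j => ?_⟩
  · simp only [reduceIte]
    grind
  · have := Q.star_star (c 0 i)
    grind

/-- Here the condition at the maximum forces the free label of the minimum. -/
theorem rigid_zigzag_right (i : ℕ) : Q.Rigid [Slice.cup (i + 1), Slice.cap i] := by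
  refine Q.rigid_pair fun s₀ s₁ s₁' s₂ h1 h2 h1' h2' => ?_
  rw [across_cup] at h1 h1'
  rw [across_cap] at h2 h2'
  obtain ⟨x, h1⟩ := h1
  obtain ⟨y, h1'⟩ := h1'
  have : x = y := by
    have e := h2.1
    have e' := h2'.1
    rw [h1] at e
    rw [h1'] at e'
    grind
  rw [h1, h1', this]

theorem transfers_slide_cup (b : Bool) (i : ℕ) :
    Q.Transfers [Slice.cup i, Slice.cross b (i + 1)] [Slice.cup (i + 1), Slice.cross (!b) i] := by
  refine Q.transfers_of_exists fun s₀ s₁ s₂ h1 h2 => ?_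
  simp only [across_cup, across_cross] at *
  obtain ⟨x, h1⟩ := h1
  -- For `b = false` the vertical strand passes over, so the left leg of the new arc undergoes an
  -- undercrossing, which has to be undone at the minimum.
  refine ⟨_, ⟨if b then x else Q.act (Q.star (s₀ i)) x, rfl⟩, ?_⟩
  have e1 := Q.act_star_act (s₀ i) x
  have e2 := Q.act_star (Q.star (s₀ i)) x
  rw [h2, h1]
  funext j
  cases b <;> grind

theorem transfers_slide_cup_symm (b : Bool) (i : ℕ) :
    Q.Transfers [Slice.cup (i + 1), Slice.cross (!b) i] [Slice.cup i, Slice.cross b (i + 1)] := by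
  refine Q.transfers_of_exists fun s₀ s₁ s₂ h1 h2 => ?_
  simp only [across_cup, across_cross] at *
  obtain ⟨x, h1⟩ := h1
  refine ⟨_, ⟨if b then x else Q.act (s₀ i) x, rfl⟩, ?_⟩
  have e1 := Q.star_act_act (s₀ i) x
  have e2 := Q.act_star (Q.star (s₀ i)) (Q.act (s₀ i) x)
  rw [h2, h1]
  funext j
  cases b <;> grind

theorem transfers_slide_cap (b : Bool) (i : ℕ) :
    Q.Transfers [Slice.cross b (i + 1), Slice.cap i] [Slice.cross (!b) i, Slice.cap (i + 1)] := by
  refine Q.transfers_of_exists fun s₀ s₁ s₂ h1 h2 => ?_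
  simp only [across_cap, across_cross] at *
  refine ⟨_, rfl, ?_⟩
  have e1 := Q.star_act_act (s₀ (i + 1)) (s₀ (i + 2))
  have e2 := Q.act_star (Q.star (s₀ (i + 1))) (s₀ i)
  have e3 := Q.act_star (s₀ (i + 1)) (s₀ i)
  have e4 := Q.star_star (s₀ i)
  have e5 := Q.act_star (s₀ (i + 2)) (s₀ (i + 1))
  have e6 := Q.act_star_act (s₀ (i + 2)) (s₀ (i + 1))
  have e7 := Q.act_star (Q.star (s₀ (i + 2))) (s₀ (i + 1))
  obtain ⟨h3, h4⟩ := h2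
  rw [h1] at h3
  rw [h4, h1]
  refine ⟨?_, funext fun j => ?_⟩ <;> cases b <;> grind

theorem transfers_slide_cap_symm (b : Bool) (i : ℕ) :
    Q.Transfers [Slice.cross (!b) i, Slice.cap (i + 1)] [Slice.cross b (i + 1), Slice.cap i] := by
  refine Q.transfers_of_exists fun s₀ s₁ s₂ h1 h2 => ?_
  simp only [across_cap, across_cross] at *
  refine ⟨_, rfl, ?_⟩
  have e1 := Q.act_star_act (s₀ (i + 1)) (s₀ i)
  have e2 := Q.act_star (s₀ (i + 1)) (Q.act (Q.star (s₀ (i + 1))) (s₀ i))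
  have e5 := Q.act_star (s₀ i) (s₀ (i + 1))
  have e6 := Q.star_act_act (s₀ i) (s₀ (i + 1))
  have e7 := Q.star_star (s₀ i)
  have e8 := Q.act_star (s₀ i) (Q.act (s₀ i) (s₀ (i + 1)))
  obtain ⟨h3, h4⟩ := h2
  rw [h1] at h3
  rw [h4, h1]
  refine ⟨?_, funext fun j => ?_⟩ <;> cases b <;> grind

theorem transfers_reidemeister_one_cup (b : Bool) (i : ℕ) :
    Q.Transfers [Slice.cup i, Slice.cross b i] [Slice.cup i] := by
  intro c hc
  simp only [isColoring_cons, isColoring_nil, and_true, across_cup, across_cross, zero_add,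
    Nat.reduceAdd] at hc
  obtain ⟨⟨x, h1⟩, h2⟩ := hc
  refine ⟨fun k => if k = 0 then c 0 else c 2, ?_, rfl, rfl⟩
  simp only [isColoring_cons, isColoring_nil, and_true, across_cup]
  -- The kink exchanges the two legs of the minimum, so the label `x` becomes `star x`.
  refine ⟨Q.star x, ?_⟩
  have e1 := Q.star_star x
  have e2 := Q.act_self x
  have e3 := Q.act_star x x
  simp only [reduceIte, one_ne_zero]
  rw [h2, h1]
  funext j
  cases b <;> grind

theorem transfers_reidemeister_one_cup_symm (b : Bool) (i : ℕ) :
    Q.Transfers [Slice.cup i] [Slice.cup i, Slice.cross b i] := by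
  intro c hc
  simp only [isColoring_cons, isColoring_nil, and_true, across_cup] at hc
  obtain ⟨x, h1⟩ := hc
  refine ⟨fun k => if k = 0 then c 0 else if k = 1 then (fun j => if j < i then c 0 j else
    if j = i then Q.star x else if j = i + 1 then Q.star (Q.star x) else c 0 (j - 2)) else c 1,
    ?_, rfl, rfl⟩
  simp only [isColoring_cons, isColoring_nil, and_true, across_cup, across_cross, zero_add,
    Nat.reduceAdd]
  refine ⟨⟨Q.star x, rfl⟩, ?_⟩
  have e1 := Q.star_star x
  have e2 := Q.act_self x
  have e3 := Q.act_star x x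
  have e4 := Q.act_self (Q.star x)
  have e5 := Q.act_star (Q.star x) (Q.star x)
  simp only [reduceIte, one_ne_zero, OfNat.ofNat_ne_zero, OfNat.ofNat_ne_one]
  rw [h1]
  funext j
  cases b <;> grind

/-- A crossing is invertible, so the middle line can be recovered from the top line alone. -/
theorem rigid_cup_cross (b : Bool) (i j : ℕ) : Q.Rigid [Slice.cup i, Slice.cross b j] := by
  refine Q.rigid_pair fun s₀ s₁ s₁' s₂ h1 h2 h1' h2' => funext fun l => ?_
  have e : s₂ = _ := across_cross.1 h2
  have e' : s₂ = _ := across_cross.1 h2'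
  have l0 := congrFun e l
  have l0' := congrFun e' l
  have j0 := congrFun e j
  have j0' := congrFun e' j
  have j1 := congrFun e (j + 1)
  have j1' := congrFun e' (j + 1)
  have k1 := Q.star_act_act (s₁ j) (s₁ (j + 1))
  have k2 := Q.star_act_act (s₁' j) (s₁' (j + 1))
  have k3 := Q.act_star_act (s₁ (j + 1)) (s₁ j)
  have k4 := Q.act_star_act (s₁' (j + 1)) (s₁' j)
  clear e e' h1 h2 h1' h2'
  cases b <;> grind

theorem rigid_cross_cap (b : Bool) (i j : ℕ) : Q.Rigid [Slice.cross b j, Slice.cap i] :=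
  Q.rigid_pair fun _ _ _ _ h1 _ h1' _ => h1.eq_of_cross h1'

/-- The over-label acts invertibly and fixes itself, so its action cancels from the condition at the
maximum. -/
theorem transfers_reidemeister_one_cap (b : Bool) (i : ℕ) :
    Q.Transfers [Slice.cross b i, Slice.cap i] [Slice.cap i] := by
  intro c hc
  simp only [isColoring_cons, isColoring_nil, and_true, across_cap, across_cross, zero_add,
    Nat.reduceAdd] at hc
  obtain ⟨h1, h2, h3⟩ := hc
  refine ⟨fun k => if k = 0 then c 0 else c 2, ?_, rfl, rfl⟩
  simp only [isColoring_cons, isColoring_nil, and_true, across_cap]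
  have e1 := Q.star_star (c 0 i)
  have e2 := Q.act_self (c 0 i)
  have e3 := Q.act_star (c 0 i) (c 0 i)
  have e4 := Q.star_act_act (c 0 i) (c 0 (i + 1))
  have e5 := Q.act_star (Q.star (c 0 i)) (c 0 i)
  have e6 := Q.act_self (Q.star (c 0 i))
  have e7 := Q.act_star_act (c 0 (i + 1)) (c 0 i)
  have e8 := Q.act_self (c 0 (i + 1))
  have e9 := Q.act_star (c 0 (i + 1)) (c 0 (i + 1))
  have e10 := Q.star_star (c 0 (i + 1))
  have e11 := Q.star_star (Q.act (Q.star (c 0 (i + 1))) (c 0 i))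
  have e13 := Q.star_star (Q.act (c 0 i) (c 0 (i + 1)))
  have e12 := Q.act_star (c 0 (i + 1)) (Q.act (Q.star (c 0 (i + 1))) (c 0 i))
  simp only [reduceIte, one_ne_zero]
  rw [h1] at h2
  rw [h3, h1]
  refine ⟨?_, funext fun j => ?_⟩ <;> cases b <;> grind

theorem transfers_reidemeister_one_cap_symm (b : Bool) (i : ℕ) :
    Q.Transfers [Slice.cap i] [Slice.cross b i, Slice.cap i] := by
  intro c hc
  simp only [isColoring_cons, isColoring_nil, and_true, across_cap] at hc
  obtain ⟨h1, h2⟩ := hc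
  refine ⟨fun k => if k = 0 then c 0 else if k = 1 then (fun j => if j = i then c 0 (i + 1) else
    if j = i + 1 then c 0 i else c 0 j) else c 1, ?_, rfl, rfl⟩
  simp only [isColoring_cons, isColoring_nil, and_true, across_cap, across_cross, zero_add,
    Nat.reduceAdd]
  have e1 := Q.star_star (c 0 i)
  have e2 := Q.act_self (c 0 i)
  have e3 := Q.act_star (c 0 i) (c 0 i)
  simp only [reduceIte, one_ne_zero, OfNat.ofNat_ne_zero, OfNat.ofNat_ne_one]
  rw [h2]
  refine ⟨funext fun j => ?_, ?_, funext fun j => ?_⟩ <;> cases b <;> grind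

theorem transfers_reidemeister_two (b : Bool) (i : ℕ) :
    Q.Transfers [Slice.cross b i, Slice.cross (!b) i] [] := by
  intro c hc
  simp only [isColoring_cons, isColoring_nil, and_true, across_cross, zero_add,
    Nat.reduceAdd] at hc
  obtain ⟨h1, h2⟩ := hc
  refine ⟨fun _ => c 0, Q.isColoring_nil _, rfl, ?_⟩
  change c 0 = c 2
  have e1 := Q.star_act_act (c 0 i) (c 0 (i + 1))
  have e2 := Q.act_star_act (c 0 (i + 1)) (c 0 i)
  rw [h2, h1]
  funext j
  cases b <;> grind

theorem transfers_reidemeister_two_symm (b : Bool) (i : ℕ) :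
    Q.Transfers [] [Slice.cross b i, Slice.cross (!b) i] := by
  intro c _
  refine ⟨fun k => if k = 1 then (fun j =>
      if j = i then (if b then Q.act (c 0 i) (c 0 (i + 1)) else c 0 (i + 1)) else
      if j = i + 1 then (if b then c 0 i else Q.act (Q.star (c 0 (i + 1))) (c 0 i)) else c 0 j)
      else c 0, ?_, rfl, rfl⟩
  simp only [isColoring_cons, isColoring_nil, and_true, across_cross, zero_add,
    Nat.reduceAdd, reduceIte, OfNat.ofNat_ne_one, zero_ne_one, true_and]
  have e1 := Q.star_act_act (c 0 i) (c 0 (i + 1))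
  have e2 := Q.act_star_act (c 0 (i + 1)) (c 0 i)
  funext j
  cases b <;> grind

theorem rigid_reidemeister_two (b b' : Bool) (i : ℕ) :
    Q.Rigid [Slice.cross b i, Slice.cross b' i] :=
  Q.rigid_pair fun _ _ _ _ h1 _ h1' _ => h1.eq_of_cross h1'

/-- The labels above a crossing. -/
def crossed (b : Bool) (i : ℕ) (s : ℕ → X) : ℕ → X := fun j =>
  if j = i then (if b then Q.act (s i) (s (i + 1)) else s (i + 1)) else
    if j = i + 1 then (if b then s i else Q.act (Q.star (s (i + 1))) (s i)) else s j

/-- Self-distributivity, for `b = false` applied to the reversed over-labels. -/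
theorem crossed_crossed_crossed (b : Bool) (i : ℕ) (s : ℕ → X) :
    Q.crossed b i (Q.crossed b (i + 1) (Q.crossed b i s)) =
      Q.crossed b (i + 1) (Q.crossed b i (Q.crossed b (i + 1) s)) := by
  have e1 := Q.act_act (s i) (s (i + 1)) (s (i + 2))
  have e2 := Q.act_act (Q.star (s (i + 2))) (Q.star (s (i + 1))) (s i)
  have e3 := Q.act_star (Q.star (s (i + 2))) (s (i + 1))
  funext j
  unfold crossed
  cases b <;> grind

theorem transfers_three_crossings {b : Bool} {i j k i' j' k' : ℕ}
    (h : ∀ s, Q.crossed b k (Q.crossed b j (Q.crossed b i s)) =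
      Q.crossed b k' (Q.crossed b j' (Q.crossed b i' s))) :
    Q.Transfers [Slice.cross b i, Slice.cross b j, Slice.cross b k]
      [Slice.cross b i', Slice.cross b j', Slice.cross b k'] := by
  have e : ∀ (i : ℕ) (s s' : ℕ → X), Q.Across (Slice.cross b i) s s' ↔ s' = Q.crossed b i s :=
    fun _ _ _ => across_cross
  intro c hc
  simp only [isColoring_cons, isColoring_nil, and_true, e, zero_add, Nat.reduceAdd] at hc
  obtain ⟨h1, h2, h3⟩ := hc
  refine ⟨fun n => if n = 0 then c 0 else if n = 1 then Q.crossed b i' (c 0) else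
    if n = 2 then Q.crossed b j' (Q.crossed b i' (c 0)) else c 3, ?_, rfl, rfl⟩
  simp [isColoring_cons, isColoring_nil, e]
  rw [← h, h3, h2, h1]

theorem rigid_reidemeister_three (b : Bool) (i j k : ℕ) :
    Q.Rigid [Slice.cross b i, Slice.cross b j, Slice.cross b k] := by
  intro c c' hc hc' h0 h3 l hl
  simp only [isColoring_cons, isColoring_nil, and_true, zero_add, Nat.reduceAdd] at hc hc'
  simp only [List.length_cons, List.length_nil, zero_add, Nat.reduceAdd] at h3 hl
  have h1 : c 1 = c' 1 := hc.1.eq_of_cross (h0 ▸ hc'.1)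
  have h2 : c 2 = c' 2 := hc.2.1.eq_of_cross (h1 ▸ hc'.2.1)
  interval_cases l <;> assumption

/-- Transfers in both directions carry colorings across the move; rigidity makes what happens inside
the move determined by what happens outside, so nothing is lost or gained. -/
theorem _root_.Move.transfers {a b : List Slice} (h : Move a b) :
    Q.Transfers a b ∧ Q.Transfers b a ∧ Q.Rigid a ∧ Q.Rigid b := by
  cases h with
  | exchange A B i d =>
    exact ⟨Q.transfers_of_exists fun _ _ _ => Across.exchange,
      Q.transfers_of_exists fun _ _ _ => Across.exchange_symm,
      Q.rigid_pair fun _ _ _ _ => Across.exchange_unique,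
      Q.rigid_pair fun _ _ _ _ => Across.exchange_symm_unique⟩
  | zigzag_left i =>
    exact ⟨Q.transfers_zigzag_left i, Q.transfers_zigzag_left_symm i, Q.rigid_zigzag_left i,
      Q.rigid_nil⟩
  | zigzag_right i =>
    exact ⟨Q.transfers_zigzag_right i, Q.transfers_zigzag_right_symm i, Q.rigid_zigzag_right i,
      Q.rigid_nil⟩
  | slide_cup b i =>
    exact ⟨Q.transfers_slide_cup b i, Q.transfers_slide_cup_symm b i, Q.rigid_cup_cross _ _ _,
      Q.rigid_cup_cross _ _ _⟩
  | slide_cap b i =>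
    exact ⟨Q.transfers_slide_cap b i, Q.transfers_slide_cap_symm b i, Q.rigid_cross_cap _ _ _,
      Q.rigid_cross_cap _ _ _⟩
  | reidemeister_one_cup b i =>
    exact ⟨Q.transfers_reidemeister_one_cup b i, Q.transfers_reidemeister_one_cup_symm b i,
      Q.rigid_cup_cross _ _ _, Q.rigid_singleton _⟩
  | reidemeister_one_cap b i =>
    exact ⟨Q.transfers_reidemeister_one_cap b i, Q.transfers_reidemeister_one_cap_symm b i,
      Q.rigid_cross_cap _ _ _, Q.rigid_singleton _⟩
  | reidemeister_two b i =>
    exact ⟨Q.transfers_reidemeister_two b i, Q.transfers_reidemeister_two_symm b i,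
      Q.rigid_reidemeister_two _ _ _, Q.rigid_nil⟩
  | reidemeister_three b i =>
    exact ⟨Q.transfers_three_crossings fun s => Q.crossed_crossed_crossed b i s,
      Q.transfers_three_crossings fun s => (Q.crossed_crossed_crossed b i s).symm,
      Q.rigid_reidemeister_three _ _ _ _, Q.rigid_reidemeister_three _ _ _ _⟩

end SymmetricQuandle

/-! ### The number of points on a line -/

/-- The number of points on the line number `k`, if there are `m` points at the bottom. -/
def lineWidth (m : ℕ) (w : List Slice) (k : ℕ) : ℕ := (w.take k).foldl Slice.after m

@[simp] theorem lineWidth_zero (m : ℕ) (w : List Slice) : lineWidth m w 0 = m := rfl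

@[simp] theorem lineWidth_cons_succ (m : ℕ) (p : Slice) (w : List Slice) (k : ℕ) :
    lineWidth m (p :: w) (k + 1) = lineWidth (p.after m) w k := rfl

theorem lineWidth_append_left (m : ℕ) {v : List Slice} (w : List Slice) {k : ℕ}
    (hk : k ≤ v.length) : lineWidth m (v ++ w) k = lineWidth m v k := by
  rw [lineWidth, lineWidth, List.take_append_of_le_length hk]

theorem lineWidth_append_right (m : ℕ) (v w : List Slice) (k : ℕ) :
    lineWidth m (v ++ w) (v.length + k) = lineWidth (lineWidth m v v.length) w k := by
  rw [lineWidth, lineWidth, lineWidth, List.take_length_add_append, List.foldl_append,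
    List.take_length]

theorem Fits.lineWidth_length {m n : ℕ} {w : List Slice} (h : Fits m w n) :
    lineWidth m w w.length = n := by
  induction w generalizing m with
  | nil => exact h
  | cons p w ih => exact ih h.2

theorem Fits.lineWidth_succ {m n : ℕ} {w : List Slice} (h : Fits m w n) {k : ℕ} {p : Slice}
    (hp : w[k]? = some p) :
    p.pos + p.kind.ins ≤ lineWidth m w k ∧ lineWidth m w (k + 1) = p.after (lineWidth m w k) := by
  induction w generalizing m k with
  | nil => simp at hp
  | cons q w ih =>
    rcases k with _ | k
    · simp at hp
      subst hp
      exact ⟨h.1, rfl⟩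
    · exact ih h.2 (by simpa using hp)

theorem Fits.exists_rest {m n : ℕ} {w : List Slice} (h : Fits m w n) {k : ℕ} {p : Slice}
    (hp : w[k]? = some p) : ∃ r, lineWidth m w k = p.pos + p.kind.ins + r ∧
      lineWidth m w (k + 1) = p.pos + p.kind.outs + r := by
  obtain ⟨h1, h2⟩ := h.lineWidth_succ hp
  refine ⟨lineWidth m w k - (p.pos + p.kind.ins), by omega, ?_⟩
  rw [h2, Slice.after]
  omega

theorem Fits.lineWidth_right {m n : ℕ} {w : List Slice} (h : Fits m w n) (r k : ℕ) :
    lineWidth (m + r) w k = lineWidth m w k + r := by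
  induction w generalizing m k with
  | nil => simp [lineWidth]
  | cons p w ih =>
    rcases k with _ | k
    · rfl
    · have h1 := h.1
      rw [lineWidth_cons_succ, lineWidth_cons_succ, ← ih h.2]
      congr 1
      simp only [Slice.after]; omega

theorem Fits.lineWidth_left {m n : ℕ} {w : List Slice} (h : Fits m w n) (r k : ℕ) :
    lineWidth (r + m) (w.map (Slice.shift r)) k = r + lineWidth m w k := by
  induction w generalizing m k with
  | nil => simp [lineWidth]
  | cons p w ih =>
    rcases k with _ | k
    · rfl
    · have h1 := h.1
      rw [List.map_cons, lineWidth_cons_succ, lineWidth_cons_succ, ← ih h.2]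
      congr 1
      simp only [Slice.after, Slice.shift]; omega

theorem Fits.lineWidth_one_pos {n : ℕ} {w : List Slice} (h : Fits 0 w n) (hw : w ≠ []) :
    0 < lineWidth 0 w 1 := by
  rcases w with _ | ⟨⟨A, i⟩, w⟩
  · exact absurd rfl hw
  · have h1 := h.1
    rcases A with _ | _ | _ <;> simp_all [Slice.after, SliceKind.ins, SliceKind.outs]

theorem Tangle.mem_points {m n : ℕ} {D : Tangle m n} {k j : ℕ} :
    (k, j) ∈ D.points ↔ k ≤ D.word.length ∧ j < lineWidth m D.word k := by
  simp only [Tangle.points, Finset.mem_biUnion, Finset.mem_range, Finset.mem_map]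
  constructor
  · rintro ⟨k, hk, j, hj, h⟩
    obtain ⟨rfl, rfl⟩ := Prod.mk.inj h
    exact ⟨by omega, hj⟩
  · rintro ⟨hk, hj⟩
    exact ⟨k, by omega, j, hj, rfl⟩

namespace SymmetricQuandle

variable {X Y : Type*} {Q : SymmetricQuandle X} {R : SymmetricQuandle Y}

/-! ### Colorings and the strands outside a diagram -/

/-- Lines carry labels at all natural positions, so a coloring also labels fictitious vertical
strands to the right of the diagram. No slice touches them. This avoids carrying widths through the
moves. -/
theorem IsColoring.outside {m n : ℕ} {w : List Slice} (h : Fits m w n) {c : ℕ → ℕ → X}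
    (hc : Q.IsColoring w c) {k : ℕ} (hk : k ≤ w.length) (d : ℕ) :
    c k (lineWidth m w k + d) = c 0 (m + d) := by
  induction k with
  | zero => rfl
  | succ k ih =>
    obtain ⟨p, hp⟩ : ∃ p, w[k]? = some p := ⟨_, List.getElem?_eq_getElem hk⟩
    obtain ⟨r, h1, h2⟩ := h.exists_rest hp
    rw [← ih (by omega), h1, h2]
    simpa only [add_assoc] using (hc k p hp).2.1 (r + d)

/-- The labels of the strands to the right of the diagram may be chosen freely, provided each keeps
its label on all lines. -/
theorem IsColoring.mix {m n : ℕ} {w : List Slice} (h : Fits m w n) {c c' : ℕ → ℕ → X}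
    (hc : Q.IsColoring w c) (t : ℕ → X)
    (hc' : ∀ k ≤ w.length, ∀ d, c' k (lineWidth m w k + d) = t d) :
    Q.IsColoring w (fun k j => if j < lineWidth m w k then c k j else c' k j) := by
  intro k p hp
  obtain ⟨r, h1, h2⟩ := h.exists_rest hp
  have hk : k < w.length := (List.getElem?_eq_some_iff.1 hp).1
  obtain ⟨a1, a2, a3⟩ := hc k p hp
  refine ⟨fun j hj => ?_, fun d => ?_, a3.congr (fun e he => ?_) (fun e he => ?_)⟩ <;>
    simp only [h1, h2]
  · rw [if_pos (by omega), if_pos (by omega), a1 j hj]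
  · by_cases hd : d < r
    · rw [if_pos (by omega), if_pos (by omega), a2]
    · rw [if_neg (by omega), if_neg (by omega)]
      have e1 := hc' k hk.le (d - r)
      have e2 := hc' (k + 1) hk (d - r)
      rw [h1, add_assoc, Nat.add_sub_cancel' (by omega)] at e1
      rw [h2, add_assoc, Nat.add_sub_cancel' (by omega)] at e2
      rw [e1, e2]
  · rw [if_pos (by omega)]
  · rw [if_pos (by omega)]

theorem IsColoring.of_shift {r : ℕ} {w : List Slice} {c : ℕ → ℕ → X}
    (hc : Q.IsColoring (w.map (Slice.shift r)) c) :
    Q.IsColoring w (fun k j => c k (r + j)) ∧ ∀ k ≤ w.length, ∀ j < r, c k j = c 0 j := by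
  constructor
  · intro k p hp
    obtain ⟨a1, a2, a3⟩ := hc k (p.shift r) (by simp [hp])
    refine ⟨fun j hj => a1 _ (by simp only [Slice.shift]; omega), fun d => ?_,
      a3.congr (fun e he => ?_) (fun e he => ?_)⟩
    · simpa only [Slice.shift, add_assoc] using a2 d
    · simp only [Slice.shift, add_assoc]
    · simp only [Slice.shift, add_assoc]
  · intro k hk j hj
    induction k with
    | zero => rfl
    | succ k ih =>
      rw [← ih (by omega)]
      exact (hc k _ (by rw [List.getElem?_map, List.getElem?_eq_getElem hk]; rfl)).1 j
        (by simp only [Slice.shift]; omega)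

theorem IsColoring.shift (r : ℕ) {w : List Slice} {c : ℕ → ℕ → X} (hc : Q.IsColoring w c)
    (s : ℕ → X) : Q.IsColoring (w.map (Slice.shift r))
      (fun k j => if j < r then s j else c k (j - r)) := by
  intro k p hp
  rw [List.getElem?_map, Option.map_eq_some_iff] at hp
  obtain ⟨p, hp, rfl⟩ := hp
  obtain ⟨a1, a2, a3⟩ := hc k p hp
  have e1 : ∀ k, ∀ j < r, (fun k j => if j < r then s j else c k (j - r)) k j = s j :=
    fun k j hj => if_pos hj
  have e2 : ∀ k j, (fun k j => if j < r then s j else c k (j - r)) k (r + j) = c k j :=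
    fun k j => by simp
  generalize (fun k j => if j < r then s j else c k (j - r)) = f at e1 e2
  refine ⟨fun j hj => ?_, fun d => ?_, a3.congr (fun e he => ?_) (fun e he => ?_)⟩
  · change j < r + p.pos at hj
    by_cases h : j < r
    · rw [e1 _ _ h, e1 _ _ h]
    · obtain ⟨j, rfl⟩ := Nat.exists_eq_add_of_le (Nat.le_of_not_lt h)
      rw [e2, e2, a1 _ (by omega)]
  · change f (k + 1) (r + p.pos + p.kind.outs + d) = f k (r + p.pos + p.kind.ins + d)
    simp only [add_assoc, e2] at a2 ⊢
    exact a2 d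
  · change f k (r + p.pos + e) = _
    rw [add_assoc, e2]
  · change f (k + 1) (r + p.pos + e) = _
    rw [add_assoc, e2]

/-! ### Change of labels -/

/-- A map which respects the operations. -/
def IsHom (Q : SymmetricQuandle X) (R : SymmetricQuandle Y) (f : X → Y) : Prop :=
  (∀ x, f (Q.star x) = R.star (f x)) ∧ ∀ y x, f (Q.act y x) = R.act (f y) (f x)

theorem IsColoring.map {f : X → Y} (hf : IsHom Q R f) {w : List Slice} {c : ℕ → ℕ → X}
    (hc : Q.IsColoring w c) : R.IsColoring w (fun k j => f (c k j)) := by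
  intro k p hp
  obtain ⟨a1, a2, a3⟩ := hc k p hp
  refine ⟨fun j hj => congrArg f (a1 j hj), fun d => congrArg f (a2 d), ?_⟩
  obtain ⟨A, i⟩ := p
  rcases A with _ | _ | (_ | _) <;> simp_all [Vertex, hf.1, hf.2]

/-- The label of a strand changes only where the direction does. -/
def trivial (star : X → X) (h : ∀ x, star (star x) = x) : SymmetricQuandle X where
  star := star
  act _ x := x
  star_star := h
  act_star _ _ := rfl
  star_act_act _ _ := rfl
  act_self _ := rfl
  act_act _ _ _ := rfl

/-! ### Colorings and moves -/

theorem IsColoring.replace {a b v v' : List Slice} (hab : Q.Transfers a b) {c : ℕ → ℕ → X}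
    (hc : Q.IsColoring (v ++ a ++ v') c) : ∃ c', Q.IsColoring (v ++ b ++ v') c' ∧
      (∀ k ≤ v.length, c' k = c k) ∧
        ∀ k, c' (v.length + b.length + k) = c (v.length + a.length + k) := by
  rw [isColoring_append, isColoring_append] at hc
  obtain ⟨⟨h1, h2⟩, h3⟩ := hc
  obtain ⟨d, hd, hd0, hd1⟩ := hab _ h2
  obtain ⟨e, he, he0, he1⟩ := h1.glue hd (by rw [hd0]; rfl)
  obtain ⟨f, hf, hf0, hf1⟩ := he.glue h3 (by rw [List.length_append, he1, hd1]; simp)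
  simp only [List.length_append] at hf0 hf1
  exact ⟨f, hf, fun k hk => by rw [hf0 k (by omega), he0 k hk], hf1⟩

theorem Rigid.eq {a v v' : List Slice} (ha : Q.Rigid a) {c c' : ℕ → ℕ → X}
    (hc : Q.IsColoring (v ++ a ++ v') c) (hc' : Q.IsColoring (v ++ a ++ v') c')
    (h1 : ∀ k ≤ v.length, c k = c' k)
    (h2 : ∀ k ≤ v'.length, c (v.length + a.length + k) = c' (v.length + a.length + k)) :
    ∀ k ≤ (v ++ a ++ v').length, c k = c' k := by
  rw [isColoring_append, isColoring_append] at hc hc'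
  have h3 := ha _ _ hc.1.2 hc'.1.2 (h1 _ (by simp)) (h2 0 (by simp))
  intro k hk
  simp only [List.length_append] at hk
  by_cases a1 : k ≤ v.length
  · exact h1 k a1
  by_cases a2 : k ≤ v.length + a.length
  · have := h3 (k - v.length) (by omega)
    simpa only [Nat.add_sub_cancel' (Nat.le_of_not_le a1)] using this
  · have := h2 (k - (v.length + a.length)) (by omega)
    simpa only [Nat.add_sub_cancel' (Nat.le_of_not_le a2)] using this

end SymmetricQuandle

/-! ### Alexander colorings -/

/-- The directions which a strand may be given, and the weight of a crossing under a strand with a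
given direction. -/
structure Directing (B K : Type*) [Field K] where
  reverse : B → B
  weight : B → Kˣ
  reverse_reverse : ∀ u, reverse (reverse u) = u
  weight_reverse : ∀ u, weight (reverse u) = (weight u)⁻¹

namespace Directing

open SymmetricQuandle

variable {B K : Type*} [Field K] (A : Directing B K)

/-- Only the directions are recorded. -/
def directions : SymmetricQuandle B := .trivial A.reverse A.reverse_reverse

/-- The Alexander quandle, with directions. -/
def quandle : SymmetricQuandle (B × K) where
  star x := (A.reverse x.1, x.2)
  act y x := (x.1, A.weight y.1 * x.2 + (1 - A.weight y.1) * y.2)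
  star_star x := by simp [A.reverse_reverse]
  act_star _ _ := rfl
  star_act_act y x := by
    have h := Units.inv_mul (A.weight y.1)
    ext
    · rfl
    · simp only [A.weight_reverse]
      linear_combination (x.2 - y.2) * h
  act_self x := by
    ext
    · rfl
    · ring
  act_act x y z := by
    ext
    · rfl
    · ring_nf

/-- `c` is an Alexander coloring of a diagram with the directions `o`. -/
def IsColoring (w : List Slice) (o : ℕ → ℕ → B) (c : ℕ → ℕ → K) : Prop :=
  A.quandle.IsColoring w (fun k j => (o k j, c k j))

variable {A}

theorem IsColoring.directions {w : List Slice} {o : ℕ → ℕ → B} {c : ℕ → ℕ → K}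
    (h : A.IsColoring w o c) : A.directions.IsColoring w o :=
  SymmetricQuandle.IsColoring.map (f := Prod.fst) ⟨fun _ => rfl, fun _ _ => rfl⟩ h

theorem isColoring_const {w : List Slice} {o : ℕ → ℕ → B} (h : A.directions.IsColoring w o)
    (x : K) : A.IsColoring w o (fun _ _ => x) :=
  SymmetricQuandle.IsColoring.map (f := fun u => (u, x))
    ⟨fun _ => rfl, fun y _ => Prod.ext rfl (by simp only [quandle]; ring)⟩ h

theorem IsColoring.affine {w : List Slice} {o : ℕ → ℕ → B} {c : ℕ → ℕ → K}
    (h : A.IsColoring w o c) (x y : K) : A.IsColoring w o (fun k j => x * c k j + y) :=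
  SymmetricQuandle.IsColoring.map (f := fun u : B × K => (u.1, x * u.2 + y))
    ⟨fun _ => rfl, fun _ _ => by ext <;> simp only [quandle]; ring⟩ h

/-- Once the directions are fixed, so are the weights, and the crossing rule is linear in the
labels. -/
theorem IsColoring.linear {w : List Slice} {o : ℕ → ℕ → B} {c c' : ℕ → ℕ → K}
    (h : A.IsColoring w o c) (h' : A.IsColoring w o c') (x y : K) :
    A.IsColoring w o (fun k j => x * c k j + y * c' k j) := by
  intro k p hp
  obtain ⟨a1, a2, a3⟩ := h k p hp
  obtain ⟨b1, b2, b3⟩ := h' k p hp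
  obtain ⟨D, i⟩ := p
  simp only [Prod.mk.injEq] at a1 a2 b1 b2
  refine ⟨fun j hj => ?_, fun d => ?_, ?_⟩
  · simp only [(a1 j hj).1, (a1 j hj).2, (b1 j hj).2]
  · simp only [(a2 d).1, (a2 d).2, (b2 d).2]
  · clear a1 a2 b1 b2
    rcases D with _ | _ | (_ | _) <;>
      simp only [Vertex, quandle, Prod.mk.injEq, add_zero] at a3 b3 ⊢
    · exact ⟨a3.1, by rw [a3.2, b3.2]⟩
    · exact ⟨a3.1, by rw [a3.2, b3.2]⟩
    · refine ⟨⟨a3.1.1, by rw [a3.1.2, b3.1.2]⟩, a3.2.1, by rw [a3.2.2, b3.2.2]; ring⟩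
    · refine ⟨⟨a3.1.1, by rw [a3.1.2, b3.1.2]; ring⟩, a3.2.1, by rw [a3.2.2, b3.2.2]⟩

variable (A)

/-- For all directions, there are two linearly independent colorings by which the strands outside
the diagram are labelled with `0`. -/
def HasIndependentColorings (w : List Slice) : Prop :=
  ∀ o, A.directions.IsColoring w o → ∃ c c', A.IsColoring w o c ∧ A.IsColoring w o c' ∧
    c 0 = 0 ∧ c' 0 = 0 ∧
      ∀ x y : K, (∀ k ≤ w.length, ∀ j, x * c k j + y * c' k j = 0) → x = 0 ∧ y = 0

variable {A}

/-- Independence refers to vanishing everywhere, and by rigidity vanishing outside the replaced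
slices implies vanishing inside. For nonconstancy on the points, which may appear or disappear, this
would be less direct. -/
theorem HasIndependentColorings.replace {a b v v' : List Slice} (hab : A.quandle.Transfers a b)
    (hba : A.directions.Transfers b a) (ha : A.quandle.Rigid a) (hb : A.directions.Rigid b)
    (h : A.HasIndependentColorings (v ++ a ++ v')) :
    A.HasIndependentColorings (v ++ b ++ v') := by
  intro o ho
  obtain ⟨o', ho', o1, o2⟩ := ho.replace hba
  obtain ⟨c, c', hc, hc', h0, h0', hi⟩ := h o' ho'
  have key : ∀ c, A.IsColoring (v ++ a ++ v') o' c → ∃ d, A.IsColoring (v ++ b ++ v') o d ∧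
      (∀ k ≤ v.length, d k = c k) ∧
        ∀ k, d (v.length + b.length + k) = c (v.length + a.length + k) := by
    intro c hc
    obtain ⟨d, hd, d1, d2⟩ := SymmetricQuandle.IsColoring.replace hab hc
    have hd' : A.IsColoring (v ++ b ++ v') (fun k j => (d k j).1) (fun k j => (d k j).2) := hd
    -- The transferred coloring comes with directions of its own; they agree with `o` outside `b`,
    -- hence also inside.
    have e := hb.eq ho hd'.directions
      (fun k hk => funext fun j => by rw [d1 k hk, o1 k hk])
      (fun k hk => funext fun j => by rw [d2 k, o2 k])
    exact ⟨fun k j => (d k j).2, hd'.congr fun k hk => by rw [e k hk],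
      fun k hk => funext fun j => congrArg Prod.snd (congrFun (d1 k hk) j),
      fun k => funext fun j => congrArg Prod.snd (congrFun (d2 k) j)⟩
  obtain ⟨d, hd, d1, d2⟩ := key c hc
  obtain ⟨d', hd', d1', d2'⟩ := key c' hc'
  refine ⟨d, d', hd, hd', by rw [d1 0 (by simp), h0], by rw [d1' 0 (by simp), h0'],
    fun x y hxy => hi x y fun k hk j => ?_⟩
  -- The combination agrees with the zero coloring outside `a`, so rigidity extends this to `a`.
  have := ha.eq (hc.linear hc' x y) (isColoring_const ho' 0)
    (fun k hk => funext fun j => by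
      dsimp only
      rw [← d1 k hk, ← d1' k hk, hxy k (by simp; omega)])
    (fun k hk => funext fun j => by
      dsimp only
      rw [← d2 k, ← d2' k, hxy _ (by simp; omega)]) k hk
  exact congrArg Prod.snd (congrFun this j)

theorem HasIndependentColorings.of_isotopic {m n : ℕ} {D E : Tangle m n} (h : D.Isotopic E) :
    A.HasIndependentColorings D.word ↔ A.HasIndependentColorings E.word := by
  induction h with
  | rel D E h =>
    obtain ⟨v, v', a, b, hab, hD, hE⟩ := h
    obtain ⟨h1, h2, h3, h4⟩ := hab.transfers A.quandle
    obtain ⟨h1', h2', h3', h4'⟩ := hab.transfers A.directions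
    rw [hD, hE]
    exact ⟨fun h => h.replace h1 h2' h3 h4', fun h => h.replace h2 h1' h4 h3'⟩
  | refl D => rfl
  | symm D E _ ih => exact ih.symm
  | trans D E F _ _ ih ih' => exact ih.trans ih'

/-- One coloring is `1` on the points of the lower link and `0` elsewhere, the other is `1` on the
points of the upper link; each link has a point on its first line above the bottom. -/
theorem hasIndependentColorings_append {v w : List Slice} (hv : Fits 0 v 0) (hw : Fits 0 w 0)
    (hv0 : v ≠ []) (hw0 : w ≠ []) : A.HasIndependentColorings (v ++ w) := by
  intro o ho
  obtain ⟨o1, o2⟩ := A.directions.isColoring_append.1 ho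
  have mix : ∀ {u : List Slice} {o : ℕ → ℕ → B}, Fits 0 u 0 → A.directions.IsColoring u o →
      A.IsColoring u o (fun k j => if j < lineWidth 0 u k then 1 else 0) := by
    intro u o hu ho
    have := SymmetricQuandle.IsColoring.mix (c' := fun k j => (o k j, (0 : K))) hu
      (isColoring_const ho 1) (fun d => (o 0 (0 + d), 0)) fun k hk d => by rw [ho.outside hu hk]
    refine this.congr fun k _ => funext fun j => ?_
    dsimp only
    split_ifs <;> rfl
  -- The separating line contains no points, so both labellings are `0` along it.
  obtain ⟨d, d0, d1, d2⟩ := (mix hv o1).glue (isColoring_const o2 0) (by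
    simp [hv.lineWidth_length])
  obtain ⟨d', d0', d1', d2'⟩ := (isColoring_const o1 0).glue (mix hw o2) (by simp)
  have fst : ∀ k, (fun j => (d k j).1) = o k ∧ (fun j => (d' k j).1) = o k := by
    intro k
    by_cases h : k ≤ v.length
    · rw [d1 k h, d1' k h]; exact ⟨rfl, rfl⟩
    · obtain ⟨k, rfl⟩ := Nat.exists_eq_add_of_le (Nat.le_of_not_le h)
      rw [d2, d2']; exact ⟨rfl, rfl⟩
  refine ⟨fun k j => (d k j).2, fun k j => (d' k j).2, d0.congr fun k _ => funext fun j => ?_,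
    d0'.congr fun k _ => funext fun j => ?_, ?_, ?_, fun x y h => ?_⟩
  · rw [← (fst k).1]
  · rw [← (fst k).2]
  · funext j; simp [d1 0 (Nat.zero_le _)]
  · funext j; simp [d1' 0 (Nat.zero_le _)]
  · have l1 := List.length_pos_of_ne_nil hv0
    have l2 := List.length_pos_of_ne_nil hw0
    have h1 := h 1 (by simp; omega) 0
    have h2 := h (v.length + 1) (by simp; omega) 0
    simp only [d1 1 l1, d1' 1 l1] at h1
    simp only [d2, d2'] at h2
    simp only [hv.lineWidth_one_pos hv0, hw.lineWidth_one_pos hw0, reduceIte, mul_one, mul_zero,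
      add_zero, zero_add] at h1 h2
    exact ⟨h1, h2⟩

/-- A split link has colorings which are not constant. -/
theorem exists_isColoring_of_isSplit {L : LinkDiagram} (hL : L.IsSplit) {o : ℕ → ℕ → B}
    (ho : A.directions.IsColoring L.word o) :
    ∃ c, A.IsColoring L.word o c ∧ ¬ ∃ x, ∀ p ∈ L.points, c p.1 p.2 = x := by
  obtain ⟨L₁, L₂, h1, h2, h⟩ := hL
  obtain ⟨c, c', hc, hc', h0, h0', hi⟩ := (HasIndependentColorings.of_isotopic (A := A) h).2
    (hasIndependentColorings_append L₁.fits L₂.fits h1 h2) o ho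
  by_contra hcon
  push Not at hcon
  obtain ⟨x, hx⟩ := hcon c hc
  obtain ⟨x', hx'⟩ := hcon c' hc'
  have out : ∀ c, A.IsColoring L.word o c → c 0 = 0 → ∀ k ≤ L.word.length, ∀ j,
      ¬ j < lineWidth 0 L.word k → c k j = 0 := by
    intro c hc h0 k hk j hj
    have := SymmetricQuandle.IsColoring.outside L.fits hc hk (j - lineWidth 0 L.word k)
    rw [Nat.add_sub_cancel' (by omega), h0] at this
    exact congrArg Prod.snd this
  have key : ∀ a b : K, a * x + b * x' = 0 → a = 0 ∧ b = 0 := by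
    intro a b hab
    refine hi a b fun k hk j => ?_
    by_cases hj : j < lineWidth 0 L.word k
    · rw [hx (k, j) (Tangle.mem_points.2 ⟨hk, hj⟩), hx' (k, j) (Tangle.mem_points.2 ⟨hk, hj⟩), hab]
    · rw [out c hc h0 k hk j hj, out c' hc' h0' k hk j hj]; ring
  -- Two constant labellings, with values `x` and `x'`, satisfy this linear relation; it forces both
  -- values to vanish.
  have h3 := key x' (-x) (by ring)
  have h4 := key 1 0 (by rw [neg_eq_zero.1 h3.2]; ring)
  exact one_ne_zero h4.1

end Directing

/-! ### Colorings of a word enclosed by a minimum and a maximum. -/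

namespace SymmetricQuandle

variable {X : Type*} {Q : SymmetricQuandle X}

theorem isColoring_singleton {p : Slice} {c : ℕ → ℕ → X} :
    Q.IsColoring [p] c ↔ Q.Across p (c 0) (c 1) := by
  simp [isColoring_cons, isColoring_nil]

theorem Across.of_cup {i : ℕ} {s : ℕ → X} (h : s (i + 1) = Q.star (s i)) :
    Q.Across (Slice.cup i) (fun j => if j < i then s j else s (j + 2)) s := by
  refine across_cup.2 ⟨s i, funext fun j => ?_⟩
  grind

theorem Across.of_cap {i : ℕ} {s : ℕ → X} (h : s (i + 1) = Q.star (s i)) :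
    Q.Across (Slice.cap i) s (fun j => if j < i then s j else s (j + 2)) :=
  across_cap.2 ⟨h, rfl⟩

theorem IsColoring.cup_cap {i n : ℕ} {w : List Slice} {c : ℕ → ℕ → X} (hn : w.length = n)
    (hc : Q.IsColoring w c) (h0 : c 0 (i + 1) = Q.star (c 0 i))
    (h1 : c n (i + 1) = Q.star (c n i)) :
    ∃ d, Q.IsColoring ([Slice.cup i] ++ w ++ [Slice.cap i]) d ∧ (∀ k ≤ n, d (1 + k) = c k) ∧
      d 0 = (fun j => if j < i then c 0 j else c 0 (j + 2)) ∧
        d (n + 2) = fun j => if j < i then c n j else c n (j + 2) := by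
  subst hn
  have e0 : Q.IsColoring [Slice.cup i]
      (fun k => if k = 0 then (fun j => if j < i then c 0 j else c 0 (j + 2)) else c 0) :=
    isColoring_singleton.2 (Across.of_cup h0)
  have e1 : Q.IsColoring [Slice.cap i] (fun k => if k = 0 then c w.length else
      (fun j => if j < i then c w.length j else c w.length (j + 2))) :=
    isColoring_singleton.2 (Across.of_cap h1)
  obtain ⟨d, hd, d0, d1⟩ := e0.glue hc rfl
  obtain ⟨f, hf, f0, f1⟩ := hd.glue e1 (by
    rw [List.length_append, d1]; rfl)
  simp only [List.length_append, List.length_cons, List.length_nil, zero_add] at d0 d1 f0 f1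
  refine ⟨f, hf, fun k hk => by rw [f0 _ (by omega), d1], ?_, ?_⟩
  · rw [f0 0 (by omega), d0 0 (by omega)]; rfl
  · have := f1 1
    rw [show w.length + 2 = 1 + w.length + 1 by omega, this]; rfl

theorem IsColoring.of_cup_cap {i n : ℕ} {w : List Slice} {d : ℕ → ℕ → X} (hn : w.length = n)
    (hd : Q.IsColoring ([Slice.cup i] ++ w ++ [Slice.cap i]) d) :
    Q.IsColoring w (fun k => d (1 + k)) ∧ d 1 (i + 1) = Q.star (d 1 i) ∧
      d (1 + n) (i + 1) = Q.star (d (1 + n) i) ∧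
        d 0 = (fun j => if j < i then d 1 j else d 1 (j + 2)) ∧
          d (n + 2) = fun j => if j < i then d (1 + n) j else d (1 + n) (j + 2) := by
  subst hn
  rw [isColoring_append, isColoring_append, isColoring_singleton, isColoring_singleton] at hd
  simp only [List.length_append, List.length_cons, List.length_nil, zero_add, add_zero] at hd
  obtain ⟨⟨h1, h2⟩, h3⟩ := hd
  have h4 := across_cup.1 h1
  have h5 := across_cap.1 h3
  obtain ⟨x, hx⟩ := h4
  have h6 : d 1 (i + 1) = Q.star (d 1 i) := by rw [hx]; simp
  refine ⟨h2, h6, h5.1, h1.eq_of_cup (Across.of_cup h6), ?_⟩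
  rw [← h5.2]; congr 1; omega

end SymmetricQuandle

namespace Tangle

open SymmetricQuandle

variable {X : Type*} {Q : SymmetricQuandle X} (S T : Tangle 2 2)

/-! ### Closures and sums -/

theorem length_numerator : T.numerator.word.length = T.word.length + 2 := by
  simp [numerator]

theorem length_sum : (S.sum T).word.length = S.word.length + T.word.length + 2 := by
  simp [Tangle.sum]; omega

theorem lineWidth_numerator {k : ℕ} (hk : k ≤ T.word.length) :
    lineWidth 0 T.numerator.word (1 + k) = lineWidth 2 T.word k := by
  have : T.numerator.word = [Slice.cup 0] ++ (T.word ++ [Slice.cap 0]) := by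
    simp [numerator]
  rw [this, ← lineWidth_append_left 2 [Slice.cap 0] hk]
  exact lineWidth_append_right 0 [Slice.cup 0] _ k

theorem lineWidth_sum_left {k : ℕ} (hk : k ≤ S.word.length) :
    lineWidth 2 (S.sum T).word (1 + k) = lineWidth 2 S.word k + 2 := by
  have : (S.sum T).word =
      [Slice.cup 1] ++ (S.word ++ (T.word.map (Slice.shift 2) ++ [Slice.cap 1])) := by
    simp [Tangle.sum]
  rw [this, ← S.fits.lineWidth_right, ← lineWidth_append_left _ _ hk]
  exact lineWidth_append_right 2 [Slice.cup 1] _ k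

theorem lineWidth_sum_right {k : ℕ} (hk : k ≤ T.word.length) :
    lineWidth 2 (S.sum T).word (1 + S.word.length + k) = 2 + lineWidth 2 T.word k := by
  have : (S.sum T).word =
      ([Slice.cup 1] ++ S.word) ++ (T.word.map (Slice.shift 2) ++ [Slice.cap 1]) := by
    simp [Tangle.sum]
  have e : 1 + S.word.length = ([Slice.cup 1] ++ S.word).length := by simp; omega
  have e' : lineWidth 2 ([Slice.cup 1] ++ S.word) ([Slice.cup 1] ++ S.word).length = 4 :=
    Fits.lineWidth_length (Fits.append (n := 4) (by
      simp [Fits, Slice.cup, Slice.after, SliceKind.ins, SliceKind.outs]) (S.fits.right 2))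
  rw [this, e, lineWidth_append_right, e', lineWidth_append_left _ _ (by simpa using hk)]
  exact T.fits.lineWidth_left 2 k

variable {S T}

theorem mem_points_numerator {k j : ℕ} (hk : k ≤ T.word.length) :
    (1 + k, j) ∈ T.numerator.points ↔ j < lineWidth 2 T.word k := by
  rw [mem_points, length_numerator, lineWidth_numerator T hk]
  simp; omega

theorem exists_of_mem_points_numerator {p : ℕ × ℕ} (hp : p ∈ T.numerator.points) :
    ∃ k j, k ≤ T.word.length ∧ j < lineWidth 2 T.word k ∧ p = (1 + k, j) := by
  obtain ⟨k, j⟩ := p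
  have hp' := mem_points.1 hp
  rcases k with _ | k
  · simp at hp'
  · rw [length_numerator] at hp'
    by_cases hk : k ≤ T.word.length
    · rw [add_comm] at hp ⊢
      exact ⟨k, j, hk, (mem_points_numerator hk).1 hp, rfl⟩
    · have := T.numerator.fits.lineWidth_length
      rw [length_numerator] at this
      rw [show k + 1 = T.word.length + 2 by omega, this] at hp'
      omega

theorem mem_points_sum_left {k j : ℕ} (hk : k ≤ S.word.length) (hj : j < lineWidth 2 S.word k) :
    (2 + k, j) ∈ (S.sum T).numerator.points := by
  rw [show 2 + k = 1 + (1 + k) by omega, mem_points_numerator (by rw [length_sum]; omega),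
    lineWidth_sum_left S T hk]
  omega

theorem mem_points_sum_right {k j : ℕ} (hk : k ≤ T.word.length) (hj : j < lineWidth 2 T.word k) :
    (2 + S.word.length + k, 2 + j) ∈ (S.sum T).numerator.points := by
  rw [show 2 + S.word.length + k = 1 + (1 + S.word.length + k) by omega,
    mem_points_numerator (by rw [length_sum]; omega), lineWidth_sum_right S T hk]
  omega

variable (S T)

theorem exists_isColoring_numerator {c : ℕ → ℕ → X} (hc : Q.IsColoring T.word c)
    (h0 : c 0 1 = Q.star (c 0 0)) (h1 : c T.word.length 1 = Q.star (c T.word.length 0)) :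
    ∃ d, Q.IsColoring T.numerator.word d ∧ ∀ k ≤ T.word.length, d (1 + k) = c k := by
  obtain ⟨d, hd, hd1, -⟩ := hc.cup_cap (i := 0) rfl h0 h1
  exact ⟨d, hd, hd1⟩

theorem isColoring_of_numerator {d : ℕ → ℕ → X} (hd : Q.IsColoring T.numerator.word d) :
    Q.IsColoring T.word (fun k => d (1 + k)) ∧ d 1 1 = Q.star (d 1 0) ∧
      d (1 + T.word.length) 1 = Q.star (d (1 + T.word.length) 0) := by
  obtain ⟨h1, h2, h3, -⟩ := IsColoring.of_cup_cap (i := 0) rfl hd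
  exact ⟨h1, h2, h3⟩

/-- Colorings of two tangles which fit together give a coloring of `N(S + T)`. -/
theorem exists_isColoring_sum {c c' : ℕ → ℕ → X} (hc : Q.IsColoring S.word c)
    (hc' : Q.IsColoring T.word c') (h1 : c' 0 0 = Q.star (c 0 1)) (h2 : c' 0 1 = Q.star (c 0 0))
    (h3 : c' T.word.length 0 = Q.star (c S.word.length 1))
    (h4 : c' T.word.length 1 = Q.star (c S.word.length 0)) :
    ∃ d, Q.IsColoring (S.sum T).numerator.word d ∧
      (∀ k ≤ S.word.length, ∀ j < lineWidth 2 S.word k, d (2 + k) j = c k j) ∧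
        ∀ k ≤ T.word.length, ∀ j, d (2 + S.word.length + k) (2 + j) = c' k j := by
  have e1 := hc.mix S.fits (c' := fun k j => c' 0 (j - lineWidth 2 S.word k)) (c' 0)
    fun k _ d => by simp
  have e2 := hc'.shift 2 (c S.word.length)
  obtain ⟨m, hm, m1, m2⟩ := e1.glue e2 (by
    funext j
    simp only [S.fits.lineWidth_length])
  have hl : (S.word ++ T.word.map (Slice.shift 2)).length = S.word.length + T.word.length := by
    simp
  have w0 : lineWidth 2 S.word 0 = 2 := rfl
  obtain ⟨s, hs, s1, s2, s3⟩ := hm.cup_cap (i := 1) hl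
    (by rw [m1 0 (by omega)]; simp [w0, h1])
    (by rw [m2]; simp [h3])
  have hl' : (S.sum T).word.length = S.word.length + T.word.length + 2 := length_sum S T
  obtain ⟨d, hd, d1, -⟩ := hs.cup_cap (i := 0) hl'
    (by rw [s2, m1 0 (by omega)]; simp [w0, h2])
    (by rw [s3, m2]; simp [h4])
  refine ⟨d, hd, fun k hk j hj => ?_, fun k hk j => ?_⟩
  · rw [show 2 + k = 1 + (1 + k) by omega, d1 _ (by omega), s1 _ (by omega), m1 _ hk]
    simp [hj]
  · rw [show 2 + S.word.length + k = 1 + (1 + (S.word.length + k)) by omega, d1 _ (by omega),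
      s1 _ (by omega), m2]
    simp [show ¬ 2 + j ≤ 1 by omega]

theorem isColoring_of_sum {d : ℕ → ℕ → X} (hd : Q.IsColoring (S.sum T).numerator.word d) :
    Q.IsColoring S.word (fun k => d (2 + k)) ∧
      Q.IsColoring T.word (fun k j => d (2 + S.word.length + k) (2 + j)) ∧ d 1 0 = d 2 0 ∧
      d (2 + S.word.length) 2 = Q.star (d 2 1) ∧ d (2 + S.word.length) 3 = Q.star (d 2 0) ∧
      d (2 + S.word.length + T.word.length) 2 = Q.star (d (2 + S.word.length) 1) ∧
      d (2 + S.word.length + T.word.length) 3 = Q.star (d (2 + S.word.length) 0) := by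
  obtain ⟨h1, h2, h3⟩ := isColoring_of_numerator _ hd
  have hl : (S.word ++ T.word.map (Slice.shift 2)).length = S.word.length + T.word.length := by
    simp
  obtain ⟨g1, g2, g3, g4, g5⟩ := IsColoring.of_cup_cap (i := 1) hl h1
  obtain ⟨f1, f2⟩ := Q.isColoring_append.1 g1
  obtain ⟨e1, e2⟩ := f2.of_shift
  rw [length_sum] at h3
  simp only [show ∀ k, 1 + (1 + k) = 2 + k by omega, ← add_assoc, Nat.reduceAdd, add_zero] at *
  have out : ∀ j, d (2 + S.word.length) (2 + j) = d 2 (2 + j) := fun j => by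
    have := IsColoring.outside S.fits f1 le_rfl j
    rwa [S.fits.lineWidth_length] at this
  have b0 := congrFun g4 0
  have b1 := congrFun g4 1
  have t0 := congrFun g5 0
  have t1 := congrFun g5 1
  have top := e2 T.word.length le_rfl
  simp only [zero_lt_one, lt_self_iff_false, reduceIte, zero_add, Nat.reduceAdd] at b0 b1 t0 t1
  exact ⟨f1, e1, b0, (out 0).trans g2, (out 1).trans (by rw [← b1, h2, b0]),
    by rw [g3, top 1 one_lt_two], by rw [← t1, h3, t0, top 0 two_pos]⟩

/-! ### Knots -/

theorem IsKnot.eq_of_adjacent {Y : Type*} {L : LinkDiagram} (hL : L.IsKnot) {f : ℕ × ℕ → Y}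
    (hf : ∀ a b, L.Adjacent a b → f a = f b) {a b : ℕ × ℕ} (ha : a ∈ L.points)
    (hb : b ∈ L.points) : f a = f b := by
  have h := hL.2 a ha b hb
  clear ha hb
  induction h with
  | rel a b h => exact hf a b h
  | refl a => rfl
  | symm a b _ ih => exact ih.symm
  | trans a b c _ _ ih ih' => exact ih.trans ih'

section

variable {star : X → X} {hs : ∀ x, star (star x) = x} {m n : ℕ} {D : Tangle m n} {c : ℕ → ℕ → X}

theorem Straight.eq_of_isColoring {Q : SymmetricQuandle X} (hc : Q.IsColoring D.word c)
    {a b : ℕ × ℕ} (h : D.Straight a b) : c a.1 a.2 = c b.1 b.2 := by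
  cases h with
  | left k j p hp hj => exact ((hc k p hp).1 j hj).symm
  | right k d p hp => exact ((hc k p hp).2.1 d).symm

theorem OverStrand.eq_of_isColoring {Q : SymmetricQuandle X} (hc : Q.IsColoring D.word c)
    {a b : ℕ × ℕ} (h : D.OverStrand a b) : c a.1 a.2 = c b.1 b.2 := by
  cases h with
  | rising k i hp => exact (hc k _ hp).2.2.2.symm
  | falling k i hp => exact (hc k _ hp).2.2.1.symm

theorem Turn.eq_of_isColoring {Q : SymmetricQuandle X} (hc : Q.IsColoring D.word c)
    {a b : ℕ × ℕ} (h : D.Turn a b) : c b.1 b.2 = Q.star (c a.1 a.2) := by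
  cases h with
  | cup k i hp => exact (hc k _ hp).2.2
  | cap k i hp => exact (hc k _ hp).2.2

theorem UnderStrand.eq_of_isColoring (hc : (SymmetricQuandle.trivial star hs).IsColoring D.word c)
    {a b : ℕ × ℕ} (h : D.UnderStrand a b) : c a.1 a.2 = c b.1 b.2 := by
  cases h with
  | falling k i hp => exact (hc k _ hp).2.2.1.symm
  | rising k i hp => exact (hc k _ hp).2.2.2.symm

end

theorem IsKnot.eq_of_isColoring_id {L : LinkDiagram} (hL : L.IsKnot) {c : ℕ → ℕ → X}
    (hc : (SymmetricQuandle.trivial (fun x : X => x) fun _ => rfl).IsColoring L.word c)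
    {a b : ℕ × ℕ} (ha : a ∈ L.points) (hb : b ∈ L.points) : c a.1 a.2 = c b.1 b.2 :=
  hL.eq_of_adjacent (f := fun a => c a.1 a.2) (by
    rintro a b (h | h | h | h)
    · exact h.eq_of_isColoring hc
    · exact h.eq_of_isColoring hc
    · exact h.eq_of_isColoring hc
    · exact (h.eq_of_isColoring hc).symm) ha hb

/-- The colorings of a diagram by this quandle are the orientations of the diagram. -/
def orientations : SymmetricQuandle Bool := .trivial not Bool.not_not

theorem IsOrientation.isColoring {m n : ℕ} {D : Tangle m n} {up : ℕ × ℕ → Bool}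
    (h : D.IsOrientation up) : orientations.IsColoring D.word (fun k j => up (k, j)) := by
  intro k p hp
  refine ⟨fun j hj => (h.1 _ _ (.inl (.left k j p hp hj))).symm,
    fun d => (h.1 _ _ (.inl (.right k d p hp))).symm, ?_⟩
  obtain ⟨A, i⟩ := p
  rcases A with _ | _ | (_ | _)
  · have := h.2 _ _ (.cup k i hp)
    simp only [Vertex, orientations, SymmetricQuandle.trivial, add_zero]
    generalize up (k + 1, i) = x at *
    generalize up (k + 1, i + 1) = y at *
    revert x y; decide
  · have := h.2 _ _ (.cap k i hp)
    simp only [Vertex, orientations, SymmetricQuandle.trivial, add_zero]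
    generalize up (k, i) = x at *
    generalize up (k, i + 1) = y at *
    revert x y; decide
  · exact ⟨(h.1 _ _ (.inr (.inl (.falling k i hp)))).symm,
      (h.1 _ _ (.inr (.inr (.rising k i hp)))).symm⟩
  · exact ⟨(h.1 _ _ (.inr (.inr (.falling k i hp)))).symm,
      (h.1 _ _ (.inr (.inl (.rising k i hp)))).symm⟩

/-- Both orientations flip at the same places, so whether they agree is constant along the knot. -/
theorem IsKnot.orientation_unique {L : LinkDiagram} (hL : L.IsKnot) {o o' : ℕ → ℕ → Bool}
    (ho : orientations.IsColoring L.word o) (ho' : orientations.IsColoring L.word o')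
    {a b : ℕ × ℕ} (ha : a ∈ L.points) (hb : b ∈ L.points) (h : o a.1 a.2 = o' a.1 a.2) :
    o b.1 b.2 = o' b.1 b.2 := by
  have := hL.eq_of_adjacent (f := fun a => o a.1 a.2 == o' a.1 a.2) (by
    rintro a b (h | h | h | h)
    · simp only [h.eq_of_isColoring ho, h.eq_of_isColoring ho']
    · simp only [h.eq_of_isColoring ho, h.eq_of_isColoring ho']
    · simp only [h.eq_of_isColoring ho, h.eq_of_isColoring ho']
    · simp only [h.eq_of_isColoring ho, h.eq_of_isColoring ho']
      simp [orientations, SymmetricQuandle.trivial]) ha hb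
  simp only [h, beq_self_eq_true] at this
  exact beq_iff_eq.1 this.symm

/-! ### Conservation of flow -/

/-- If labels change sign at the minima and maxima and do not change elsewhere, then the sum of the
labels is the same on all lines. -/
theorem _root_.SymmetricQuandle.IsColoring.sum_eq {K : Type*} [AddCommGroup K] {m n : ℕ}
    {w : List Slice} (h : Fits m w n) {c : ℕ → ℕ → K}
    (hc : (SymmetricQuandle.trivial (fun x : K => -x) neg_neg).IsColoring w c) :
    ∑ j ∈ Finset.range n, c w.length j = ∑ j ∈ Finset.range m, c 0 j := by
  have key : ∀ k ≤ w.length, ∑ j ∈ Finset.range (lineWidth m w k), c k j =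
      ∑ j ∈ Finset.range m, c 0 j := by
    intro k hk
    induction k with
    | zero => rfl
    | succ k ih =>
      obtain ⟨p, hp⟩ : ∃ p, w[k]? = some p := ⟨_, List.getElem?_eq_getElem hk⟩
      obtain ⟨r, h1, h2⟩ := h.exists_rest hp
      obtain ⟨a1, a2, a3⟩ := hc k p hp
      rw [← ih (by omega), h1, h2, Finset.sum_range_add, Finset.sum_range_add,
        Finset.sum_range_add, Finset.sum_range_add]
      congr 1
      · congr 1
        · exact Finset.sum_congr rfl fun j hj => a1 j (Finset.mem_range.1 hj)
        · obtain ⟨A, i⟩ := p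
          rcases A with _ | _ | (_ | _) <;>
            simp only [Vertex, SymmetricQuandle.trivial, add_zero] at a3 <;>
            simp [SliceKind.ins, SliceKind.outs, Finset.sum_range_succ, a3, add_comm]
      · exact Finset.sum_congr rfl fun j _ => a2 j
  rw [← h.lineWidth_length]
  exact key _ le_rfl

/-- The sign of a direction. -/
def sign (K : Type*) [Ring K] (u : Bool) : K := if u then 1 else -1

theorem isColoring_sign_mul {K : Type*} [Ring K] {w : List Slice} {o : ℕ → ℕ → Bool}
    {c : ℕ → ℕ → K} (ho : orientations.IsColoring w o)
    (hc : (SymmetricQuandle.trivial (fun x : K => x) fun _ => rfl).IsColoring w c) :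
    (SymmetricQuandle.trivial (fun x : K => -x) neg_neg).IsColoring w
      (fun k j => sign K (o k j) * c k j) := by
  intro k p hp
  obtain ⟨a1, a2, a3⟩ := ho k p hp
  obtain ⟨b1, b2, b3⟩ := hc k p hp
  refine ⟨fun j hj => by dsimp only; rw [a1 j hj, b1 j hj],
    fun d => by dsimp only; rw [a2, b2], ?_⟩
  obtain ⟨A, i⟩ := p
  have hs : ∀ u, sign K (!u) = - sign K u := by intro u; cases u <;> simp [sign]
  clear a1 a2 b1 b2
  rcases A with _ | _ | (_ | _) <;>
    simp only [Vertex, orientations, SymmetricQuandle.trivial, add_zero] at a3 b3 ⊢ <;> simp [a3, b3, hs]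

end Tangle

/-! ### The two kinds of directed labels in use. -/

namespace Directing

/-- Strands have no direction, and all crossings have weight `1`. -/
def undirected (K : Type*) [Field K] : Directing Unit K where
  reverse u := u
  weight _ := 1
  reverse_reverse _ := rfl
  weight_reverse _ := inv_one.symm

/-- The strands are directed upwards or downwards. -/
def ofUnit {K : Type*} [Field K] (z : Kˣ) : Directing Bool K where
  reverse u := !u
  weight u := if u then z else z⁻¹
  reverse_reverse := Bool.not_not
  weight_reverse u := by cases u <;> simp

theorem IsColoring.of_undirected {K : Type*} [Field K] {w : List Slice} {o : ℕ → ℕ → Unit}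
    {c : ℕ → ℕ → K} (h : (undirected K).IsColoring w o c) :
    (SymmetricQuandle.trivial (fun x : K => x) fun _ => rfl).IsColoring w c :=
  SymmetricQuandle.IsColoring.map (f := Prod.snd)
    ⟨fun _ => rfl, fun _ _ => by simp [quandle, undirected, SymmetricQuandle.trivial]⟩ h

theorem isColoring_unit {w : List Slice} (K : Type*) [Field K] (o : ℕ → ℕ → Unit) :
    (undirected K).directions.IsColoring w o := by
  intro k p _
  refine ⟨fun _ _ => rfl, fun _ => rfl, ?_⟩
  obtain ⟨A, i⟩ := p
  rcases A with _ | _ | (_ | _)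
  · rfl
  · rfl
  · exact ⟨rfl, rfl⟩
  · exact ⟨rfl, rfl⟩

end Directing

/-! ### Gluing a coloring of `N(T)` to one of `N(S)`. -/

namespace Tangle

open SymmetricQuandle Directing

variable {S T : Tangle 2 2}

/-- The strands of `S` join NW to NE and SW to SE, if `N(S + T)` is a knot and `N(S)` is split. -/
theorem ends_ne (hST : (S.sum T).numerator.IsKnot) (hS : S.numerator.IsSplit)
    {o : ℕ → ℕ → Bool} (ho : orientations.IsColoring (S.sum T).numerator.word o) :
    o 2 1 = !o 2 0 ∧ o (2 + S.word.length) 1 = !o (2 + S.word.length) 0 := by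
  obtain ⟨oS, -⟩ := isColoring_of_sum S T ho
  have flow := (isColoring_sign_mul (K := ℚ) oS (c := fun _ _ => 1) (by
    simpa using IsColoring.of_undirected
      (isColoring_const (isColoring_unit ℚ fun _ _ => ()) 1))).sum_eq S.fits
  simp only [Finset.sum_range_succ, Finset.sum_range_zero, zero_add, mul_one, add_zero] at flow
  -- The flow of the constant `1` counts directions: opposite bottom ends have sum `0`, so the top
  -- ends must be opposite as well.
  suffices h : o 2 1 ≠ o 2 0 by
    revert h flow
    generalize o 2 0 = a
    generalize o 2 1 = b
    generalize o (2 + S.word.length) 0 = a'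
    generalize o (2 + S.word.length) 1 = b'
    cases a <;> cases b <;> cases a' <;> cases b' <;> simp [sign]
  intro h
  obtain ⟨g, hg, hne⟩ := exists_isColoring_of_isSplit hS (isColoring_unit ℚ fun _ _ => ())
  replace hg := hg.of_undirected
  obtain ⟨g1, g2, g3⟩ := isColoring_of_numerator S hg
  have flow' := (isColoring_sign_mul oS g1).sum_eq S.fits
  change g 1 1 = g 1 0 at g2
  change g (1 + S.word.length) 1 = g (1 + S.word.length) 0 at g3
  simp only [Finset.sum_range_succ, Finset.sum_range_zero, zero_add, add_zero, g2, g3] at flow'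
  -- With parallel bottom ends, the flow of `1` makes all four ends point the same way, and the flow
  -- of `g` then equates twice its top label with twice its bottom label.
  have e : g (1 + S.word.length) 0 = g 1 0 := by
    revert h flow flow'
    generalize o 2 0 = a
    generalize o 2 1 = b
    generalize o (2 + S.word.length) 0 = a'
    generalize o (2 + S.word.length) 1 = b'
    cases a <;> cases b <;> cases a' <;> cases b' <;> simp [sign] <;> intros <;> linarith
  have hc : (SymmetricQuandle.trivial (fun x : ℚ => x) fun _ => rfl).IsColoring T.word
      (fun _ _ => g 1 0) :=
    (isColoring_const (isColoring_unit ℚ fun _ _ => ()) (g 1 0)).of_undirected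
  obtain ⟨d, hd, d1, -⟩ := exists_isColoring_sum S T g1 hc g2.symm rfl
    (by rw [g3, e]; rfl) (by rw [e]; rfl)
  refine hne ⟨d 2 0, fun p hp => ?_⟩
  obtain ⟨k, j, hk, hj, rfl⟩ := exists_of_mem_points_numerator hp
  rw [← d1 k hk j hj]
  exact hST.eq_of_isColoring_id hd (mem_points_sum_left hk hj)
    (mem_points_sum_left (k := 0) (by omega) (by simp))

/-- A coloring of `N(T)` which is not constant gives such a coloring of `N(S + T)`. -/
theorem exists_isColoring_sum_of_numerator {K : Type*} [Field K] (z : Kˣ)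
    (hST : (S.sum T).numerator.IsKnot) (hT : T.numerator.IsKnot) (hS : S.numerator.IsSplit)
    {o oT : ℕ → ℕ → Bool} {c : ℕ → ℕ → K}
    (ho : orientations.IsColoring (S.sum T).numerator.word o) (ho0 : o 1 0 = false)
    (hc : (ofUnit z).IsColoring T.numerator.word oT c) (hoT : oT 1 0 = false)
    (hne : ¬ ∃ x, ∀ p ∈ T.numerator.points, c p.1 p.2 = x) :
    ∃ o' d, (ofUnit z).IsColoring (S.sum T).numerator.word o' d ∧
      (∀ p ∈ (S.sum T).numerator.points, o' p.1 p.2 = o p.1 p.2) ∧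
        ¬ ∃ x, ∀ p ∈ (S.sum T).numerator.points, d p.1 p.2 = x := by
  obtain ⟨h1, h2⟩ := ends_ne hST hS ho
  obtain ⟨o1, o2, o3, o4, o5, o6, o7⟩ := isColoring_of_sum S T ho
  simp only [orientations, SymmetricQuandle.trivial] at o4 o5 o6 o7
  rw [o3] at ho0
  rw [ho0, Bool.not_false] at h1
  rw [h1, Bool.not_true] at o4
  rw [ho0, Bool.not_false] at o5
  rw [h2, Bool.not_not] at o6
  obtain ⟨oS', hoS', e1⟩ := exists_isColoring_numerator S o1 (by rw [h1, ho0]; rfl) h2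
  obtain ⟨oT', hoT', e2⟩ := exists_isColoring_numerator T o2 (by simp [o4, o5]; rfl)
    (by simp [o6, o7, orientations, SymmetricQuandle.trivial])
  have w1 : lineWidth 2 T.word T.word.length = 2 := T.fits.lineWidth_length
  -- The normalizations `ho0` and `hoT` make the given orientation of `N(T)` agree at one point with
  -- the one restricted from `N(S + T)`, hence at all points.
  have top : oT (1 + T.word.length) 0 = o (2 + S.word.length) 0 := by
    have := hT.orientation_unique hc.directions hoT' (a := (1 + 0, 0))
      (b := (1 + T.word.length, 0)) ((mem_points_numerator (by omega)).2 (by simp))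
      ((mem_points_numerator le_rfl).2 (by omega))
      (by simp [e2 0, o4, hoT])
    simpa [e2, o6] using this
  obtain ⟨s, hs, hs0⟩ := exists_isColoring_of_isSplit (A := ofUnit z) hS hoS'
  obtain ⟨s1, s2, s3⟩ := isColoring_of_numerator S hs
  obtain ⟨c1, c2, c3⟩ := isColoring_of_numerator T hc
  simp only [quandle, ofUnit, Prod.mk.injEq, top, hoT, Bool.not_false] at s2 s3 c2 c3
  have key : ∃ s' c' : ℕ → ℕ → K, (ofUnit z).IsColoring S.word (fun k => oS' (1 + k)) s' ∧
      (ofUnit z).IsColoring T.word (fun k => oT (1 + k)) c' ∧ s' 0 1 = s' 0 0 ∧ c' 0 0 = s' 0 0 ∧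
      c' 0 1 = s' 0 0 ∧ s' S.word.length 1 = s' S.word.length 0 ∧
      c' T.word.length 0 = s' S.word.length 0 ∧ c' T.word.length 1 = s' S.word.length 0 ∧
      ∀ x, (∀ k ≤ S.word.length, ∀ j < lineWidth 2 S.word k, s' k j = x) →
        (∀ k ≤ T.word.length, ∀ j < lineWidth 2 T.word k, c' k j = x) → False := by
    by_cases hab : s 1 0 = s (1 + S.word.length) 0
    · refine ⟨fun k => s (1 + k), fun _ _ => s 1 0, s1,
        isColoring_const (isColoring_of_numerator T hc.directions).1 _, s2.2, rfl, rfl, s3.2,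
        hab, hab, fun x hx _ => hs0 ⟨x, fun p hp => ?_⟩⟩
      obtain ⟨k, j, hk, hj, rfl⟩ := exists_of_mem_points_numerator hp
      exact hx k hk j hj
    · have hab' := sub_ne_zero.2 hab
      -- Interpolation: the affine map taking the two end labels of `s` to those of `c`. It may be
      -- constant, so nonconstancy now comes from `c`.
      obtain ⟨x, y, hx, hy⟩ : ∃ x y, x * s 1 0 + y = c 1 0 ∧
          x * s (1 + S.word.length) 0 + y = c (1 + T.word.length) 0 := by
        refine ⟨(c 1 0 - c (1 + T.word.length) 0) / (s 1 0 - s (1 + S.word.length) 0),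
          c 1 0 - (c 1 0 - c (1 + T.word.length) 0) / (s 1 0 - s (1 + S.word.length) 0) * s 1 0,
          by ring, ?_⟩
        field_simp
        ring
      refine ⟨fun k j => x * s (1 + k) j + y, fun k => c (1 + k),
        IsColoring.affine s1 x y, c1, by simp [s2.2], hx.symm, c2.2.trans hx.symm,
        by simp [s3.2], hy.symm, c3.2.trans hy.symm, fun x _ hx => hne ⟨x, fun p hp => ?_⟩⟩
      obtain ⟨k, j, hk, hj, rfl⟩ := exists_of_mem_points_numerator hp
      exact hx k hk j hj
  obtain ⟨s', c', hs', hc', k1, k2, k3, k4, k5, k6, k7⟩ := key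
  obtain ⟨d, hd, d1, d2⟩ := exists_isColoring_sum S T hs' hc'
    (Prod.ext (by simp [quandle, ofUnit, hoT, e1 0, h1]) (by simp [quandle, k1, k2]))
    (Prod.ext (by simp [quandle, ofUnit, c2.1, e1 0, ho0]) (by simp [quandle, k3]))
    (Prod.ext (by simp [quandle, ofUnit, top, e1, h2]) (by simp [quandle, k4, k5]))
    (Prod.ext (by simp [quandle, ofUnit, c3.1, e1]) (by simp [quandle, k6]))
  have hd' : (ofUnit z).IsColoring (S.sum T).numerator.word (fun k j => (d k j).1)
    (fun k j => (d k j).2) := hd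
  refine ⟨fun k j => (d k j).1, fun k j => (d k j).2, hd', fun p hp => ?_, ?_⟩
  · refine hST.orientation_unique hd'.directions ho (a := (2 + 0, 0))
      (mem_points_sum_left (Nat.zero_le _) (by simp)) hp ?_
    rw [d1 0 (Nat.zero_le _) 0 (by simp)]
    simp [e1 0]
  · rintro ⟨x, hx⟩
    exact k7 x
      (fun k hk j hj => (congrArg Prod.snd (d1 k hk j hj)).symm.trans
        (hx _ (mem_points_sum_left hk hj)))
      (fun k hk j hj => (congrArg Prod.snd (d2 k hk j)).symm.trans
        (hx _ (mem_points_sum_right hk hj)))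

end Tangle

/-! ### Roots of greatest common divisors -/

/-- The integral polynomials with a given root are the multiples of one of them. -/
theorem Polynomial.exists_dvd_of_aeval_eq_zero (z : ℂ) :
    ∃ g : Polynomial ℤ, Polynomial.aeval z g = 0 ∧
      ∀ p : Polynomial ℤ, Polynomial.aeval z p = 0 → g ∣ p := by
  by_cases h : ∀ p : Polynomial ℤ, Polynomial.aeval z p = 0 → p = 0
  -- The transcendental case.
  · exact ⟨0, map_zero _, fun p hp => by rw [h p hp]⟩
  push Not at h
  obtain ⟨p₀, h0, hne⟩ := h
  have hmap : ∀ p : Polynomial ℤ,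
      Polynomial.aeval z (p.map (Int.castRingHom ℚ)) = Polynomial.aeval z p := fun p =>
    Polynomial.aeval_map_algebraMap ℚ z p
  have hint : IsIntegral ℚ z := by
    refine IsAlgebraic.isIntegral ⟨p₀.map (Int.castRingHom ℚ), ?_, by rw [hmap, h0]⟩
    rwa [Ne, Polynomial.map_eq_zero_iff (RingHom.injective_int _)]
  obtain ⟨b, hb, hp⟩ := IsLocalization.integerNormalization_spec (nonZeroDivisors ℤ) (minpoly ℚ z)
  generalize IsLocalization.integerNormalization (nonZeroDivisors ℤ) (minpoly ℚ z) = p at hp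
  change p.map (Int.castRingHom ℚ) = _ at hp
  have hb0 : b ≠ 0 := nonZeroDivisors.ne_zero hb
  have hbQ : (b : ℚ) ≠ 0 := by exact_mod_cast hb0
  have hp' : p.map (Int.castRingHom ℚ) = Polynomial.C (b : ℚ) * minpoly ℚ z := by
    rw [hp, ← Polynomial.smul_eq_C_mul, Int.cast_smul_eq_zsmul]
  have hp0 : p ≠ 0 := by
    rintro rfl
    rw [Polynomial.map_zero, eq_comm, mul_eq_zero, Polynomial.C_eq_zero] at hp'
    exact hp'.elim hbQ (minpoly.ne_zero hint)
  have hz : Polynomial.aeval z p = 0 := by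
    rw [← hmap, hp', map_mul, minpoly.aeval, mul_zero]
  refine ⟨p.primPart, Polynomial.aeval_primPart_eq_zero hp0 hz, fun q hq => ?_⟩
  -- Gauss's lemma: divisibility by a primitive polynomial may be tested over `ℚ`, where the minimal
  -- polynomial decides.
  rw [Polynomial.IsPrimitive.Int.dvd_iff_map_cast_dvd_map_cast _ _ p.isPrimitive_primPart]
  have h1 : p.primPart.map (Int.castRingHom ℚ) ∣ minpoly ℚ z := by
    have : p.primPart.map (Int.castRingHom ℚ) ∣ Polynomial.C (b : ℚ) * minpoly ℚ z := by
      rw [← hp']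
      exact Polynomial.map_dvd _ p.primPart_dvd
    exact ((Polynomial.isUnit_C.2 (isUnit_iff_ne_zero.2 hbQ)).dvd_mul_left).1 this
  exact h1.trans (minpoly.dvd ℚ z (by rw [hmap, hq]))

/-- `ℤ[T;T⁻¹]` is not a principal ideal domain, so the gcd need not be a combination of the
elements. Instead, the polynomial `g` that generates the relations of `z` divides them all, up to
units `T n`, and hence divides the gcd. -/
theorem LaurentPolynomial.eval₂_gcd_eq_zero {s : Set ℤ[T;T⁻¹]} {Δ : ℤ[T;T⁻¹]}
    (hΔ : ∀ d : ℤ[T;T⁻¹], (∀ μ ∈ s, d ∣ μ) → d ∣ Δ) (z : ℂˣ)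
    (hs : ∀ μ ∈ s, eval₂ (Int.castRingHom ℂ) z μ = 0) :
    eval₂ (Int.castRingHom ℂ) z Δ = 0 := by
  obtain ⟨g, hg, hdvd⟩ := Polynomial.exists_dvd_of_aeval_eq_zero (z : ℂ)
  have key : Polynomial.toLaurent g ∣ Δ := by
    refine hΔ _ fun μ hμ => ?_
    obtain ⟨n, p, hp⟩ := LaurentPolynomial.exists_T_pow μ
    have h1 : g ∣ p := hdvd p (by
      have := eval₂_toLaurent (Int.castRingHom ℂ) z p
      rw [hp, map_mul, hs μ hμ, zero_mul] at this
      exact this.symm)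
    have h2 : Polynomial.toLaurent g ∣ μ * LaurentPolynomial.T n := hp ▸ map_dvd _ h1
    exact ((LaurentPolynomial.isUnit_T n).dvd_mul_right).1 h2
  obtain ⟨x, rfl⟩ := key
  rw [map_mul, eval₂_toLaurent]
  exact mul_eq_zero_of_left hg _

/-! ### Minors and relations between the columns -/

/-- If all minors of size `#P - 1` vanish, then the linear system with the given rows has a solution
which is not constant. -/
theorem Finset.exists_relation_of_minors_eq_zero {ι K : Type*} [DecidableEq ι] [Field K]
    {P : Finset ι} (hP : P.Nonempty) (R : Set (ι → K))
    (h : ∀ (r : Fin (P.card - 1) → ι → K) (c : Fin (P.card - 1) → ι), (∀ a, r a ∈ R) →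
      (∀ b, c b ∈ P) → (Matrix.of fun a b => r a (c b)).det = 0) :
    ∃ f : ι → K, (∀ p ∉ P, f p = 0) ∧ (∀ r ∈ R, ∑ p ∈ P, r p * f p = 0) ∧
      ¬ ∃ x, ∀ p ∈ P, f p = x := by
  obtain ⟨q, hq⟩ := hP
  have e : Fin (P.card - 1) ≃ P.erase q :=
    (Finset.equivFinOfCardEq (Finset.card_erase_of_mem hq)).symm
  set φ : (ι → K) → Fin (P.card - 1) → K := fun r b => r (e b) with hφ
  -- If the rows without column `q` spanned, a basis chosen among them would be a square matrix with
  -- nonzero determinant.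
  have hW : Submodule.span K (φ '' R) ≠ ⊤ := by
    intro htop
    obtain ⟨B, hB, hspan, hli⟩ := exists_linearIndependent K (φ '' R)
    rw [htop] at hspan
    let β := Module.Basis.mk hli (by rw [Subtype.range_coe, hspan])
    let i : Fin (P.card - 1) ≃ B := (Pi.basisFun K _).indexEquiv β
    choose r hr hr' using fun b : B => hB b.2
    have hdet := h (fun a => r (i a)) (fun b => e b) (fun a => hr _)
      (fun b => Finset.mem_of_mem_erase (e b).2)
    have hli' : LinearIndependent K (Matrix.of fun a b => r (i a) (e b)).row := by
      have hrow : (Matrix.of fun a b => r (i a) (e b)).row = Subtype.val ∘ i :=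
        funext fun a => hr' (i a)
      rw [hrow]
      exact hli.comp i i.injective
    rw [Matrix.linearIndependent_rows_iff_isUnit, Matrix.isUnit_iff_isUnit_det, hdet] at hli'
    exact not_isUnit_zero hli'
  obtain ⟨g, hg, hker⟩ := Submodule.exists_le_ker_of_lt_top _ (lt_top_iff_ne_top.2 hW)
  -- A nonzero functional killing the truncated rows, extended by `0` at `q`; if `f` were constant
  -- on `P`, it would be `0` there.
  let f : ι → K := fun p => if hp : p ∈ P.erase q then g (Pi.single (e.symm ⟨p, hp⟩) 1) else 0
  have fe : ∀ b, f (e b) = g (Pi.single b 1) := fun b => by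
    have := (e b).2
    simp only [f, dif_pos this, Subtype.coe_eta, Equiv.symm_apply_apply]
  have fq : f q = 0 := dif_neg (by simp)
  refine ⟨f, fun p hp => dif_neg fun h => hp (Finset.mem_of_mem_erase h), fun r hr => ?_, ?_⟩
  · have h1 : g (φ r) = 0 := hker (Submodule.subset_span ⟨r, hr, rfl⟩)
    rw [LinearMap.pi_apply_eq_sum_univ] at h1
    rw [← Finset.add_sum_erase P _ hq, fq, mul_zero, zero_add, ← Finset.sum_coe_sort,
      ← Equiv.sum_comp e, ← h1]
    refine Finset.sum_congr rfl fun b _ => ?_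
    rw [fe, smul_eq_mul, hφ]
    congr 3
    funext j
    simp [Pi.single_apply, eq_comm]
  · rintro ⟨x, hx⟩
    refine hg ((Pi.basisFun K _).ext fun b => ?_)
    rw [Pi.basisFun_apply, ← fe, hx _ (Finset.mem_of_mem_erase (e b).2), ← hx q hq, fq]
    rfl

/-- If a linear system has solutions which are constant and solutions which are not, then its
minors of size `#P - 1` vanish. -/
theorem Finset.minor_eq_zero {ι K : Type*} [DecidableEq ι] [Field K] {P : Finset ι} {f : ι → K}
    {r : Fin (P.card - 1) → ι → K} {c : Fin (P.card - 1) → ι} (hc : ∀ b, c b ∈ P)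
    (h1 : ∀ a, ∑ p ∈ P, r a p = 0) (hr : ∀ a, ∑ p ∈ P, r a p * f p = 0)
    (hf : ¬ ∃ x, ∀ p ∈ P, f p = x) : (Matrix.of fun a b => r a (c b)).det = 0 := by
  by_cases hinj : Function.Injective c
  swap
  · simp only [Function.Injective, not_forall] at hinj
    obtain ⟨b, b', hbb, hne⟩ := hinj
    exact Matrix.det_zero_of_column_eq hne fun a => by simp [hbb]
  have hP : P.Nonempty := by
    by_contra hP
    rw [Finset.not_nonempty_iff_eq_empty] at hP
    subst hP
    exact hf ⟨0, by simp⟩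
  have himg : (Finset.univ.image c).card = P.card - 1 := by
    rw [Finset.card_image_of_injective _ hinj, Finset.card_fin]
  have hsub : Finset.univ.image c ⊆ P := by
    intro p hp
    obtain ⟨b, -, rfl⟩ := Finset.mem_image.1 hp
    exact hc b
  have hpos := hP.card_pos
  obtain ⟨q, hq⟩ : ∃ q, P \ Finset.univ.image c = {q} := by
    rw [← Finset.card_eq_one, Finset.card_sdiff_of_subset hsub, himg]
    omega
  have hqP : q ∈ P := by
    have : q ∈ P \ Finset.univ.image c := by rw [hq]; simp
    exact (Finset.mem_sdiff.1 this).1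
  -- Subtracting a constant makes the solution vanish at the one omitted column `q`, so the rest is
  -- a nonzero kernel vector of the minor.
  refine Matrix.exists_mulVec_eq_zero_iff.1 ⟨fun b => f (c b) - f q, fun h0 => hf ⟨f q, ?_⟩, ?_⟩
  · intro p hp
    by_cases hpc : p ∈ Finset.univ.image c
    · obtain ⟨b, -, rfl⟩ := Finset.mem_image.1 hpc
      exact sub_eq_zero.1 (congrFun h0 b)
    · have : p ∈ P \ Finset.univ.image c := Finset.mem_sdiff.2 ⟨hp, hpc⟩
      rw [hq, Finset.mem_singleton] at this
      rw [this]
  · funext a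
    have h2 : ∑ p ∈ P, r a p * (f p - f q) = 0 := by
      simp only [mul_sub, Finset.sum_sub_distrib, hr, ← Finset.sum_mul, h1, zero_mul, sub_zero]
    rw [← Finset.sum_sdiff hsub, hq, Finset.sum_singleton, sub_self, mul_zero, zero_add,
      Finset.sum_image fun _ _ _ _ h => hinj h] at h2
    exact h2

namespace Tangle

open SymmetricQuandle Directing

variable {m n : ℕ} {D : Tangle m n}

/-! ### Colorings and the Alexander matrix -/

/-- The value of a row of the Alexander matrix, evaluated at `z`, on a labelling of the points. -/
noncomputable def pairing (D : Tangle m n) (z : ℂˣ) (r : ℕ × ℕ → ℤ[T;T⁻¹]) (f : ℕ × ℕ → ℂ) : ℂ :=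
  ∑ p ∈ D.points, LaurentPolynomial.eval₂ (Int.castRingHom ℂ) z (r p) * f p

theorem pairing_sub (z : ℂˣ) (r r' : ℕ × ℕ → ℤ[T;T⁻¹]) (f : ℕ × ℕ → ℂ) :
    D.pairing z (r - r') f = D.pairing z r f - D.pairing z r' f := by
  simp [pairing, sub_mul]

theorem pairing_smul (z : ℂˣ) (x : ℤ[T;T⁻¹]) (r : ℕ × ℕ → ℤ[T;T⁻¹]) (f : ℕ × ℕ → ℂ) :
    D.pairing z (x • r) f =
      LaurentPolynomial.eval₂ (Int.castRingHom ℂ) z x * D.pairing z r f := by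
  simp [pairing, mul_assoc, Finset.mul_sum]

theorem pairing_single (z : ℂˣ) (a : ℕ × ℕ) {f : ℕ × ℕ → ℂ} (hf : ∀ p ∉ D.points, f p = 0) :
    D.pairing z (Pi.single a 1) f = f a := by
  by_cases ha : a ∈ D.points
  · rw [pairing, Finset.sum_eq_single_of_mem a ha]
    · simp
    · intro b _ hb
      simp [hb]
  · rw [hf a ha]
    refine Finset.sum_eq_zero fun p hp => ?_
    rw [Pi.single_eq_of_ne (fun h : p = a => ha (h ▸ hp)), map_zero, zero_mul]

theorem pairing_foxRow (z : ℂˣ) (a b c : ℕ × ℕ) {f : ℕ × ℕ → ℂ} (hf : ∀ p ∉ D.points, f p = 0) :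
    D.pairing z (foxRow a b c) f = f a - z * f b - (1 - z) * f c := by
  simp [foxRow, pairing_sub, pairing_smul, pairing_single z _ hf]

/-- Where the crossing rule has weight `z`, it is the Fox relation itself; where it has weight
`z⁻¹`, the Fox relation gives the lower under-label in terms of the upper one and has to be
inverted. -/
theorem isColoring_of_pairing_eq_zero {z : ℂˣ} {up : ℕ × ℕ → Bool} (hup : D.IsOrientation up)
    {f : ℕ × ℕ → ℂ} (hf : ∀ p ∉ D.points, f p = 0)
    (h : ∀ r, D.AlexanderRow up r → D.pairing z r f = 0) :
    (ofUnit z).IsColoring D.word (fun k j => up (k, j)) (fun k j => f (k, j)) := by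
  have same : ∀ a b, D.Straight a b ∨ D.OverStrand a b ∨ D.Turn a b → f a = f b := by
    intro a b hab
    have := h _ (.same a b hab)
    rwa [pairing_sub, pairing_single z _ hf, pairing_single z _ hf, sub_eq_zero] at this
  have fox : ∀ a b c, D.AlexanderRow up (foxRow a b c) → f a = z * f b + (1 - z) * f c := by
    intro a b c habc
    have := h _ habc
    rw [pairing_foxRow z _ _ _ hf] at this
    linear_combination this
  have hz := Units.inv_mul z
  intro k p hp
  obtain ⟨a1, a2, a3⟩ := hup.isColoring k p hp
  refine ⟨fun j hj => Prod.ext (a1 j hj) (same _ _ (.inl (.left k j p hp hj))).symm,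
    fun d => Prod.ext (a2 d) (same _ _ (.inl (.right k d p hp))).symm, ?_⟩
  obtain ⟨A, i⟩ := p
  rcases A with _ | _ | (_ | _)
  · exact Prod.ext a3 (same _ _ (.inr (.inr (.cup k i hp)))).symm
  · exact Prod.ext a3 (same _ _ (.inr (.inr (.cap k i hp)))).symm
  · refine ⟨Prod.ext a3.1 (same _ _ (.inr (.inl (.falling k i hp)))).symm, Prod.ext a3.2 ?_⟩
    simp only [quandle, ofUnit, add_zero]
    cases hu : up (k, i + 1)
    · exact fox _ _ _ (.falling_down k i hp hu)
    · have := fox _ _ _ (.falling_up k i hp hu)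
      simp only [this, Bool.not_true, Bool.false_eq_true, reduceIte]
      linear_combination (f (k, i + 1) - f (k + 1, i + 1)) * hz
  · refine ⟨Prod.ext a3.1 ?_, Prod.ext a3.2 (same _ _ (.inr (.inl (.rising k i hp)))).symm⟩
    simp only [quandle, ofUnit, add_zero]
    cases hu : up (k, i)
    · have := fox _ _ _ (.rising_down k i hp hu)
      simp only [this, Bool.false_eq_true, reduceIte]
      linear_combination (f (k, i) - f (k + 1, i)) * hz
    · exact fox _ _ _ (.rising_up k i hp hu)

theorem Straight.mem_points_iff {a b : ℕ × ℕ} (h : D.Straight a b) :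
    a ∈ D.points ↔ b ∈ D.points := by
  have key : ∀ {k : ℕ} {p : Slice}, D.word[k]? = some p → k < D.word.length :=
    fun hp => (List.getElem?_eq_some_iff.1 hp).1
  cases h with
  | left k j p hp hj =>
    obtain ⟨r, h1, h2⟩ := D.fits.exists_rest hp
    have := key hp
    rw [mem_points, mem_points, h1, h2]
    omega
  | right k d p hp =>
    obtain ⟨r, h1, h2⟩ := D.fits.exists_rest hp
    have := key hp
    rw [mem_points, mem_points, h1, h2]
    omega

theorem Turn.mem_points {a b : ℕ × ℕ} (h : D.Turn a b) : a ∈ D.points ∧ b ∈ D.points := by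
  have key : ∀ {k : ℕ} {p : Slice}, D.word[k]? = some p → k < D.word.length :=
    fun hp => (List.getElem?_eq_some_iff.1 hp).1
  cases h with
  | cup k i hp =>
    obtain ⟨r, h1, h2⟩ := D.fits.exists_rest hp
    have := key hp
    rw [Tangle.mem_points, Tangle.mem_points, h2]
    simp only [Slice.cup, SliceKind.outs]
    omega
  | cap k i hp =>
    obtain ⟨r, h1, h2⟩ := D.fits.exists_rest hp
    have := key hp
    rw [Tangle.mem_points, Tangle.mem_points, h1]
    simp only [Slice.cap, SliceKind.ins]
    omega

theorem mem_points_of_cross {k i : ℕ} {b : Bool} (hp : D.word[k]? = some (Slice.cross b i)) :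
    (k, i) ∈ D.points ∧ (k, i + 1) ∈ D.points ∧ (k + 1, i) ∈ D.points ∧
      (k + 1, i + 1) ∈ D.points := by
  obtain ⟨r, h1, h2⟩ := D.fits.exists_rest hp
  have := (List.getElem?_eq_some_iff.1 hp).1
  rw [mem_points, mem_points, mem_points, mem_points, h1, h2]
  simp only [Slice.cross, SliceKind.ins, SliceKind.outs]
  omega

theorem pairing_eq_zero_of_isColoring {z : ℂˣ} {up : ℕ × ℕ → Bool} {o : ℕ → ℕ → Bool}
    {c : ℕ → ℕ → ℂ} (hc : (ofUnit z).IsColoring D.word o c)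
    (ho : ∀ p ∈ D.points, o p.1 p.2 = up p) {r : ℕ × ℕ → ℤ[T;T⁻¹]} (hr : D.AlexanderRow up r) :
    D.pairing z r (fun p => c p.1 p.2) = 0 := by
  -- The rows of type `same` include fictitious strands to the right of the diagram, which the
  -- pairing ignores; truncation makes `pairing_single` applicable to them.
  set f : ℕ × ℕ → ℂ := fun p => if p ∈ D.points then c p.1 p.2 else 0 with hf
  have h0 : ∀ p ∉ D.points, f p = 0 := fun p hp => if_neg hp
  have h1 : ∀ p ∈ D.points, f p = c p.1 p.2 := fun p hp => if_pos hp
  have e : D.pairing z r (fun p => c p.1 p.2) = D.pairing z r f :=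
    Finset.sum_congr rfl fun p hp => by rw [h1 p hp]
  have hz := Units.inv_mul z
  rw [e]
  cases hr with
  | same a b h =>
    rw [pairing_sub, pairing_single z _ h0, pairing_single z _ h0, sub_eq_zero]
    rcases h with h | h | h
    · have := congrArg Prod.snd (h.eq_of_isColoring hc)
      simp only [hf, h.mem_points_iff]
      split_ifs
      · exact this
      · rfl
    · have := congrArg Prod.snd (h.eq_of_isColoring hc)
      cases h with
      | rising k i hp =>
        obtain ⟨m1, m2, m3, m4⟩ := mem_points_of_cross hp
        rwa [h1 _ m1, h1 _ m4]
      | falling k i hp =>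
        obtain ⟨m1, m2, m3, m4⟩ := mem_points_of_cross hp
        rwa [h1 _ m2, h1 _ m3]
    · have := congrArg Prod.snd (h.eq_of_isColoring hc)
      rw [h1 _ h.mem_points.1, h1 _ h.mem_points.2]
      exact this.symm
  | rising_up k i hp hu =>
    obtain ⟨m1, m2, m3, m4⟩ := mem_points_of_cross hp
    have hv := congrArg Prod.snd (hc k _ hp).2.2.1
    have hu' := (ho _ m1).trans hu
    simp only [Slice.cross, quandle, ofUnit, add_zero] at hv hu'
    rw [pairing_foxRow z _ _ _ h0, h1 _ m1, h1 _ m2, h1 _ m3, hv]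
    simp only [hu', reduceIte]
    ring
  | rising_down k i hp hu =>
    obtain ⟨m1, m2, m3, m4⟩ := mem_points_of_cross hp
    have hv := congrArg Prod.snd (hc k _ hp).2.2.1
    have hu' := (ho _ m1).trans hu
    simp only [Slice.cross, quandle, ofUnit, add_zero] at hv hu'
    rw [pairing_foxRow z _ _ _ h0, h1 _ m1, h1 _ m2, h1 _ m3, hv]
    simp only [hu', Bool.false_eq_true, reduceIte]
    linear_combination (c k i - c k (i + 1)) * hz
  | falling_up k i hp hu =>
    obtain ⟨m1, m2, m3, m4⟩ := mem_points_of_cross hp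
    have hv := congrArg Prod.snd (hc k _ hp).2.2.2
    have hu' := (ho _ m2).trans hu
    simp only [Slice.cross, quandle, ofUnit, add_zero] at hv hu'
    rw [pairing_foxRow z _ _ _ h0, h1 _ m1, h1 _ m2, h1 _ m4, hv]
    simp only [hu', Bool.not_true, Bool.false_eq_true, reduceIte]
    linear_combination (c k (i + 1) - c k i) * hz
  | falling_down k i hp hu =>
    obtain ⟨m1, m2, m3, m4⟩ := mem_points_of_cross hp
    have hv := congrArg Prod.snd (hc k _ hp).2.2.2
    have hu' := (ho _ m2).trans hu
    simp only [Slice.cross, quandle, ofUnit, add_zero] at hv hu'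
    rw [pairing_foxRow z _ _ _ h0, h1 _ m1, h1 _ m2, h1 _ m4, hv]
    simp only [hu', Bool.not_false, reduceIte]
    ring

theorem eval₂_minor (z : ℂˣ) {k : ℕ} (r : Fin k → ℕ × ℕ → ℤ[T;T⁻¹]) (c : Fin k → ℕ × ℕ) :
    LaurentPolynomial.eval₂ (Int.castRingHom ℂ) z (Matrix.of fun a b => r a (c b)).det =
      (Matrix.of fun a b =>
        (fun a p => LaurentPolynomial.eval₂ (Int.castRingHom ℂ) z (r a p)) a (c b)).det := by
  rw [RingHom.map_det]
  rfl

/-- If the minors of the Alexander matrix vanish at `z`, then there is a coloring which is not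
constant. -/
theorem exists_isColoring_of_minors_eq_zero {z : ℂˣ} {up : ℕ × ℕ → Bool}
    (hup : D.IsOrientation up) (hD : D.points.Nonempty)
    (h : ∀ μ, D.AlexanderMinor up μ → LaurentPolynomial.eval₂ (Int.castRingHom ℂ) z μ = 0) :
    ∃ c, (ofUnit z).IsColoring D.word (fun k j => up (k, j)) c ∧
      ¬ ∃ x, ∀ p ∈ D.points, c p.1 p.2 = x := by
  obtain ⟨f, hf, h1, h2⟩ := Finset.exists_relation_of_minors_eq_zero hD
    ((fun r p => LaurentPolynomial.eval₂ (Int.castRingHom ℂ) z (r p)) '' {r | D.AlexanderRow up r})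
    (by
      intro r c hr hc
      choose r' hr' hr'' using hr
      obtain rfl : (fun a p => LaurentPolynomial.eval₂ (Int.castRingHom ℂ) z (r' a p)) = r :=
        funext hr''
      rw [← eval₂_minor]
      exact h _ ⟨r', c, hr', hc, rfl⟩)
  exact ⟨fun k j => f (k, j), isColoring_of_pairing_eq_zero hup hf fun r hr => h1 _ ⟨r, hr, rfl⟩, h2⟩

/-- If there is a coloring which is not constant, then the minors of the Alexander matrix vanish at
`z`. -/
theorem eval₂_eq_zero_of_isColoring {z : ℂˣ} {up : ℕ × ℕ → Bool} {o : ℕ → ℕ → Bool}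
    {c : ℕ → ℕ → ℂ} (hc : (ofUnit z).IsColoring D.word o c)
    (ho : ∀ p ∈ D.points, o p.1 p.2 = up p) (hne : ¬ ∃ x, ∀ p ∈ D.points, c p.1 p.2 = x)
    {μ : ℤ[T;T⁻¹]} (hμ : D.AlexanderMinor up μ) :
    LaurentPolynomial.eval₂ (Int.castRingHom ℂ) z μ = 0 := by
  obtain ⟨r, d, hr, hd, rfl⟩ := hμ
  rw [eval₂_minor]
  refine Finset.minor_eq_zero hd (fun a => ?_)
    (fun a => pairing_eq_zero_of_isColoring hc ho (hr a)) hne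
  have := pairing_eq_zero_of_isColoring (isColoring_const hc.directions (1 : ℂ)) ho (hr a)
  simpa only [pairing, mul_one] using this

end Tangle

/-- If `N(S + T)` and `N(T)` are knots and `N(S)` is a split link, then every complex root of the
Alexander polynomial of `N(T)` is a root of the Alexander polynomial of `N(S + T)`.  (Laurent
polynomials are evaluated at units, that is, at nonzero complex numbers.) -/
theorem theoremA1 (S T : Tangle 2 2)
    (hST : (S.sum T).numerator.IsKnot) (hT : T.numerator.IsKnot) (hS : S.numerator.IsSplit)
    (ΔT ΔST : ℤ[T;T⁻¹]) (hΔT : T.numerator.IsAlexanderPolynomial ΔT)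
    (hΔST : (S.sum T).numerator.IsAlexanderPolynomial ΔST)
    (z : ℂˣ) (hz : LaurentPolynomial.eval₂ (Int.castRingHom ℂ) z ΔT = 0) :
    LaurentPolynomial.eval₂ (Int.castRingHom ℂ) z ΔST = 0 := by
  obtain ⟨up, hup, hup0, hgcd⟩ := hΔST
  obtain ⟨upT, hupT, hupT0, hgcdT⟩ := hΔT
  obtain ⟨c, hc, hne⟩ := Tangle.exists_isColoring_of_minors_eq_zero (z := z) hupT hT.1
    fun μ hμ => by
      -- The polynomial of `N(T)` divides each of its minors, so they all vanish at `z`.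
      obtain ⟨x, rfl⟩ := (hgcdT ΔT).1 dvd_rfl μ hμ
      rw [map_mul, hz, zero_mul]
  obtain ⟨o', d, hd, ho', hne'⟩ := Tangle.exists_isColoring_sum_of_numerator z hST hT hS
    hup.isColoring hup0 hc hupT0 hne
  exact LaurentPolynomial.eval₂_gcd_eq_zero (fun x hx => (hgcd x).2 hx) z
    fun μ hμ => Tangle.eval₂_eq_zero_of_isColoring hd ho' hne' hμ
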